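/- Let $K$ be a number field and let $L/K$ be a finite Galois extension with cyclic Galois group $\langle\theta\rangle$ of order $d=[L:K]$. Let $0\neq\gamma\in\mathcal{O}_K$ be such that the cyclic algebra $\mathcal{A}=(L/K,\theta,\gamma)=\bigoplus_{i=0}^{d-1}u^iL$, with $xu=u\theta(x)$ for $x\in L$ and $u^d=\gamma$, is a division algebra, and suppose that its natural order $\Lambda=\bigoplus_{i=0}^{d-1}u^i\mathcal{O}_L$ is a maximal $\mathbb{Z}$-order. All ideals are two-sided; a fractional ideal is a subset $\mathcal{P}\subset\mathcal{A}$ such that $c\mathcal{P}$ is an ideal of $\Lambda$ for some $0\neq c\in K$; and for an ideal $\mathcal{I}$ we put $\mathcal{I}^{-1}=\{x\in\mathcal{A}:\mathcal{I}x\mathcal{I}\subset\mathcal{I}\}$. Let $\mathcal{I},\mathcal{J}$ be ideals of $\Lambda$, let $t\in\mathcal{I}\cap\mathcal{O}_K$ be such that $t\mathcal{I}^{-1}+\mathcal{J}=\Lambda$ (that is, $t\mathcal{I}^{-1}$ and $\mathcal{J}$ are coprime), and let $\mathcal{P}$ be a fractional ideal of $\Lambda$. Then $x\mapsto t\cdot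 x$ induces an isomorphism of left and right $\Lambda$-modules $$\chi_t:\mathcal{P}/\mathcal{J}\mathcal{P}\longrightarrow\mathcal{I}\mathcal{P}/\mathcal{I}\mathcal{J}\mathcal{P}.$$ Furthermore, for $\mathcal{J}=\langle q\rangle=q\Lambda$ with $q$ a prime number, the inverse of $\chi_t$ can be computed efficiently: there is a single deterministic algorithm whose bit cost is bounded by a fixed polynomial in the bit length of its input (uniformly in $K,L,\theta,\gamma,\mathcal{I},\mathcal{P},q,t$) and which, given the structure constants of $\Lambda$ with respect to a $\mathbb{Z}$-basis, $\mathbb{Z}$-bases of $\mathcal{I}$ and $\mathcal{P}$, the prime $q$, an element $t$ as above and some $y\in\mathcal{I}\mathcal{P}$ (all in coordinates with respect to the basis of $\Lambda$), outputs the coordinates of an $x\in\mathcal{P}$ with $\chi_t(x+q\mathcal{P})=y+q\mathcal{I}\mathcal{P}$. -/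

import Mathlib

open scoped NumberField

/-! ### Cyclic algebras -/

/-- The cyclic algebra `(L/K, θ, γ) = L ⊕ u L ⊕ ⋯ ⊕ u ^ (d - 1) L`, where `d` is the order of `θ`
(so `d = [L : K]` when `θ` generates the Galois group of the Galois extension `L/K`).
An element `x₀ + u x₁ + ⋯ + u ^ (d - 1) x_(d - 1)` is stored as its vector of coordinates. -/
def CyclicAlgebra {K L : Type*} [Field K] [Field L] [Algebra K L]
    (θ : L ≃ₐ[K] L) (_γ : K) : Type _ :=
  Fin (orderOf θ) → L

namespace CyclicAlgebra

variable {K L : Type*} [Field K] [Field L] [Algebra K L] {θ : L ≃ₐ[K] L} {γ : K}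

noncomputable instance : AddCommGroup (CyclicAlgebra θ γ) :=
  inferInstanceAs (AddCommGroup (Fin (orderOf θ) → L))

noncomputable instance : Module K (CyclicAlgebra θ γ) :=
  inferInstanceAs (Module K (Fin (orderOf θ) → L))

/-- The multiplication determined by `x u = u θ(x)` and `u ^ d = γ`:
`(u ^ i x) (u ^ j y) = u ^ (i + j) θ ^ j (x) y`, and
`u ^ (i + j) = u ^ ((i + j) % d) γ ^ ((i + j) / d)`. -/
noncomputable instance : Mul (CyclicAlgebra θ γ) where
  mul a b := fun k => ∑ i : Fin (orderOf θ), ∑ j : Fin (orderOf θ),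
    if ((i : ℕ) + (j : ℕ)) % orderOf θ = (k : ℕ) then
      (θ ^ (j : ℕ)) (a i) * b j * algebraMap K L γ ^ (((i : ℕ) + (j : ℕ)) / orderOf θ)
    else 0

noncomputable instance : One (CyclicAlgebra θ γ) where
  one := fun k => if (k : ℕ) = 0 then 1 else 0

theorem add_apply (a b : CyclicAlgebra θ γ) (k : Fin (orderOf θ)) : (a + b) k = a k + b k := rfl

theorem zero_apply (k : Fin (orderOf θ)) : (0 : CyclicAlgebra θ γ) k = 0 := rfl

theorem neg_apply (a : CyclicAlgebra θ γ) (k : Fin (orderOf θ)) : (-a) k = -a k := rfl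

theorem smul_apply (c : K) (a : CyclicAlgebra θ γ) (k : Fin (orderOf θ)) :
    (c • a) k = c • a k := rfl

theorem one_apply (k : Fin (orderOf θ)) :
    (1 : CyclicAlgebra θ γ) k = if (k : ℕ) = 0 then 1 else 0 := rfl

theorem mul_apply (a b : CyclicAlgebra θ γ) (k : Fin (orderOf θ)) :
    (a * b) k = ∑ i : Fin (orderOf θ), ∑ j : Fin (orderOf θ),
      if ((i : ℕ) + (j : ℕ)) % orderOf θ = (k : ℕ) then
        (θ ^ (j : ℕ)) (a i) * b j * algebraMap K L γ ^ (((i : ℕ) + (j : ℕ)) / orderOf θ)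
      else 0 := rfl

theorem pow_mod_apply (m : ℕ) (x : L) : (θ ^ (m % orderOf θ)) x = (θ ^ m) x := by
  rw [pow_mod_orderOf]

theorem one_mul' (a : CyclicAlgebra θ γ) : 1 * a = a := by
  funext k
  have hpos : 0 < orderOf θ := lt_of_le_of_lt (Nat.zero_le _) k.2
  rw [mul_apply, Finset.sum_eq_single (⟨0, hpos⟩ : Fin (orderOf θ))]
  · rw [Finset.sum_eq_single k]
    · simp [one_apply, Nat.mod_eq_of_lt k.2, Nat.div_eq_of_lt k.2]
    · intro j _ hj
      have : (j : ℕ) ≠ k := fun h => hj (Fin.ext h)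
      simp [Nat.mod_eq_of_lt j.2, this]
    · simp
  · intro i _ hi
    have : (i : ℕ) ≠ 0 := fun h => hi (Fin.ext h)
    simp [one_apply, this]
  · simp

theorem mul_one' (a : CyclicAlgebra θ γ) : a * 1 = a := by
  funext k
  have hpos : 0 < orderOf θ := lt_of_le_of_lt (Nat.zero_le _) k.2
  rw [mul_apply, Finset.sum_comm, Finset.sum_eq_single (⟨0, hpos⟩ : Fin (orderOf θ))]
  · rw [Finset.sum_eq_single k]
    · simp [one_apply, Nat.mod_eq_of_lt k.2, Nat.div_eq_of_lt k.2]
    · intro j _ hj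
      have : (j : ℕ) ≠ k := fun h => hj (Fin.ext h)
      simp [Nat.mod_eq_of_lt j.2, this]
    · simp
  · intro i _ hi
    have : (i : ℕ) ≠ 0 := fun h => hi (Fin.ext h)
    simp [one_apply, this]
  · simp

theorem sum_ite_mod (n : ℕ) (k₀ : Fin (orderOf θ)) (g : Fin (orderOf θ) → L) :
    ∑ l : Fin (orderOf θ), (if n % orderOf θ = (l : ℕ) then g l else 0)
      = g ⟨n % orderOf θ, Nat.mod_lt _ (lt_of_le_of_lt (Nat.zero_le _) k₀.2)⟩ := by
  rw [Finset.sum_eq_single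
    (⟨n % orderOf θ, Nat.mod_lt _ (lt_of_le_of_lt (Nat.zero_le _) k₀.2)⟩ : Fin (orderOf θ))]
  · simp
  · intro l _ hl
    have : n % orderOf θ ≠ (l : ℕ) := fun h => hl (Fin.ext h.symm)
    simp [this]
  · simp

theorem sum_reorder {ι : Type*} [Fintype ι] (F : ι → ι → ι → ι → L) :
    ∑ l, ∑ k, ∑ i, ∑ j, F l k i j = ∑ i, ∑ j, ∑ k, ∑ l, F l k i j := by
  calc ∑ l, ∑ k, ∑ i, ∑ j, F l k i j
      = ∑ l, ∑ i, ∑ j, ∑ k, F l k i j := by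
        refine Finset.sum_congr rfl fun l _ => ?_
        rw [Finset.sum_comm]
        exact Finset.sum_congr rfl fun i _ => Finset.sum_comm
    _ = ∑ i, ∑ j, ∑ l, ∑ k, F l k i j := by
        rw [Finset.sum_comm]
        exact Finset.sum_congr rfl fun i _ => Finset.sum_comm
    _ = ∑ i, ∑ j, ∑ k, ∑ l, F l k i j :=
        Finset.sum_congr rfl fun i _ => Finset.sum_congr rfl fun j _ => Finset.sum_comm

theorem div_add_div_mod (d a k : ℕ) : a / d + (a % d + k) / d = (a + k) / d := by
  rcases Nat.eq_zero_or_pos d with rfl | hd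
  · simp
  · conv_rhs => rw [← Nat.div_add_mod a d]
    rw [add_assoc, Nat.mul_add_div hd]

theorem mul_mul_apply (a b c : CyclicAlgebra θ γ) (m : Fin (orderOf θ)) :
    (a * b * c) m = ∑ i : Fin (orderOf θ), ∑ j : Fin (orderOf θ), ∑ k : Fin (orderOf θ),
      if ((i : ℕ) + j + k) % orderOf θ = (m : ℕ) then
        (θ ^ ((j : ℕ) + k)) (a i) * (θ ^ (k : ℕ)) (b j) * c k
          * algebraMap K L γ ^ (((i : ℕ) + j + k) / orderOf θ)
      else 0 := by
  have step : ∀ l k : Fin (orderOf θ),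
      (if ((l : ℕ) + k) % orderOf θ = (m : ℕ) then
        (θ ^ (k : ℕ)) ((a * b) l) * c k * algebraMap K L γ ^ (((l : ℕ) + k) / orderOf θ) else 0)
      = ∑ i : Fin (orderOf θ), ∑ j : Fin (orderOf θ),
          if ((i : ℕ) + j) % orderOf θ = (l : ℕ) then
            (if ((l : ℕ) + k) % orderOf θ = (m : ℕ) then
              (θ ^ ((j : ℕ) + k)) (a i) * (θ ^ (k : ℕ)) (b j) * c k
                * algebraMap K L γ ^ (((i : ℕ) + j) / orderOf θ + ((l : ℕ) + k) / orderOf θ)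
            else 0) else 0 := by
    intro l k
    split_ifs with h
    · rw [mul_apply, map_sum, Finset.sum_mul, Finset.sum_mul]
      refine Finset.sum_congr rfl fun i _ => ?_
      rw [map_sum, Finset.sum_mul, Finset.sum_mul]
      refine Finset.sum_congr rfl fun j _ => ?_
      split_ifs with h'
      · simp only [map_mul, map_pow, AlgEquiv.commutes]
        rw [add_comm (j : ℕ) (k : ℕ), pow_add θ, pow_add (algebraMap K L γ)]
        simp only [AlgEquiv.mul_apply]
        ring
      · simp
    · simp
  rw [mul_apply]
  simp only [step]
  rw [sum_reorder]
  refine Finset.sum_congr rfl fun i _ => Finset.sum_congr rfl fun j _ =>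
    Finset.sum_congr rfl fun k _ => ?_
  rw [sum_ite_mod _ m]
  simp only [Nat.mod_add_mod, div_add_div_mod]

theorem mul_mul_apply' (a b c : CyclicAlgebra θ γ) (m : Fin (orderOf θ)) :
    (a * (b * c)) m = ∑ i : Fin (orderOf θ), ∑ j : Fin (orderOf θ), ∑ k : Fin (orderOf θ),
      if ((i : ℕ) + j + k) % orderOf θ = (m : ℕ) then
        (θ ^ ((j : ℕ) + k)) (a i) * (θ ^ (k : ℕ)) (b j) * c k
          * algebraMap K L γ ^ (((i : ℕ) + j + k) / orderOf θ)
      else 0 := by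
  rw [mul_apply]
  refine Finset.sum_congr rfl fun i _ => ?_
  have step : ∀ l : Fin (orderOf θ),
      (if ((i : ℕ) + l) % orderOf θ = (m : ℕ) then
        (θ ^ (l : ℕ)) (a i) * (b * c) l * algebraMap K L γ ^ (((i : ℕ) + l) / orderOf θ) else 0)
      = ∑ j : Fin (orderOf θ), ∑ k : Fin (orderOf θ),
          if ((j : ℕ) + k) % orderOf θ = (l : ℕ) then
            (if ((i : ℕ) + l) % orderOf θ = (m : ℕ) then
              (θ ^ (l : ℕ)) (a i) * (θ ^ (k : ℕ)) (b j) * c k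
                * algebraMap K L γ ^ (((j : ℕ) + k) / orderOf θ + ((l : ℕ) + i) / orderOf θ)
            else 0) else 0 := by
    intro l
    split_ifs with h
    · rw [mul_apply, Finset.mul_sum, Finset.sum_mul]
      refine Finset.sum_congr rfl fun j _ => ?_
      rw [Finset.mul_sum, Finset.sum_mul]
      refine Finset.sum_congr rfl fun k _ => ?_
      split_ifs with h'
      · rw [add_comm (i : ℕ) (l : ℕ), pow_add (algebraMap K L γ)]
        ring
      · simp
    · simp
  simp only [step]
  rw [Finset.sum_comm]
  refine Finset.sum_congr rfl fun j _ => ?_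
  rw [Finset.sum_comm]
  refine Finset.sum_congr rfl fun k _ => ?_
  rw [sum_ite_mod _ m]
  have e : (j : ℕ) + k + i = i + j + k := by ring
  simp only [Nat.add_mod_mod, div_add_div_mod, pow_mod_apply, e, ← add_assoc]

noncomputable instance : Ring (CyclicAlgebra θ γ) :=
  { (inferInstance : AddCommGroup (CyclicAlgebra θ γ)) with
    mul := (· * ·)
    one := 1
    left_distrib := fun a b c => by
      funext k
      simp only [mul_apply, add_apply, ← Finset.sum_add_distrib]
      refine Finset.sum_congr rfl fun i _ => Finset.sum_congr rfl fun j _ => ?_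
      split_ifs <;> ring
    right_distrib := fun a b c => by
      funext k
      simp only [mul_apply, add_apply, ← Finset.sum_add_distrib, map_add]
      refine Finset.sum_congr rfl fun i _ => Finset.sum_congr rfl fun j _ => ?_
      split_ifs <;> ring
    zero_mul := fun a => by funext k; simp [mul_apply, zero_apply]
    mul_zero := fun a => by funext k; simp [mul_apply, zero_apply]
    mul_assoc := fun a b c => by funext m; rw [mul_mul_apply, mul_mul_apply']
    one_mul := one_mul'
    mul_one := mul_one' }

noncomputable instance : Algebra K (CyclicAlgebra θ γ) :=
  Algebra.ofModule
    (fun c a b => by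
      funext k
      simp only [mul_apply, smul_apply, Finset.smul_sum, map_smul]
      refine Finset.sum_congr rfl fun i _ => Finset.sum_congr rfl fun j _ => ?_
      split_ifs <;> simp)
    (fun c a b => by
      funext k
      simp only [mul_apply, smul_apply, Finset.smul_sum]
      refine Finset.sum_congr rfl fun i _ => Finset.sum_congr rfl fun j _ => ?_
      split_ifs <;> simp)

end CyclicAlgebra

/-- The natural order `⨁ u ^ i 𝓞_L` of the cyclic algebra `(L/K, θ, γ)` with `γ ∈ 𝓞_K`. -/
noncomputable def naturalOrder {K L : Type*} [Field K] [Field L] [Algebra K L]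
    (θ : L ≃ₐ[K] L) (γ : 𝓞 K) : Subring (CyclicAlgebra θ (γ : K)) where
  carrier := {a | ∀ i, IsIntegral ℤ (a i)}
  zero_mem' := fun _ => isIntegral_zero
  one_mem' := fun i => by
    rw [CyclicAlgebra.one_apply]
    split_ifs
    exacts [isIntegral_one, isIntegral_zero]
  add_mem' := fun ha hb i => (ha i).add (hb i)
  neg_mem' := fun ha i => (ha i).neg
  mul_mem' := fun {a b} ha hb k => by
    rw [CyclicAlgebra.mul_apply]
    refine IsIntegral.sum _ fun i _ => IsIntegral.sum _ fun j _ => ?_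
    split_ifs
    · refine (IsIntegral.mul ?_ (hb j)).mul (IsIntegral.pow ?_ _)
      · exact (ha i).map ((θ ^ (j : ℕ)).toAlgHom.restrictScalars ℤ)
      · exact (γ.isIntegral_coe).map (IsScalarTower.toAlgHom ℤ K L)
    · exact isIntegral_zero

/-! ### Orders and their two-sided ideals -/

section Orders

variable {K A : Type*} [Field K] [Ring A] [Algebra K A]

/-- A `ℤ`-order: a subring, finitely generated as an additive group, with `ℚ · Λ = A`
(every element of `A` has a nonzero integer multiple in `Λ`). -/
def IsZOrder (Λ : Subring A) : Prop :=
  Λ.toAddSubgroup.FG ∧ ∀ a : A, ∃ m : ℤ, m ≠ 0 ∧ m • a ∈ Λ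

/-- A maximal `ℤ`-order. -/
def IsMaximalZOrder (Λ : Subring A) : Prop :=
  IsZOrder Λ ∧ ∀ Γ : Subring A, IsZOrder Γ → Λ ≤ Γ → Γ = Λ

/-- `I` (a left `Λ`-submodule of `A`) is a two-sided ideal of `Λ`. -/
def IsTwoSidedIdeal (Λ : Subring A) (I : Submodule Λ A) : Prop :=
  (∀ x ∈ I, x ∈ Λ) ∧ ∀ x ∈ I, ∀ r ∈ Λ, x * r ∈ I

variable (K) in
/-- `P` is a (two-sided) fractional ideal of `Λ`: for some nonzero `c ∈ K`, the set `c P` is a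
two-sided ideal of `Λ`. -/
def IsTwoSidedFractionalIdeal (Λ : Subring A) (P : Submodule Λ A) : Prop :=
  ∃ c : K, c ≠ 0 ∧ ∃ J : Submodule Λ A, IsTwoSidedIdeal Λ J ∧
    (J : Set A) = (fun x => c • x) '' (P : Set A)

/-- The inverse `I⁻¹ = {x ∈ A : I x I ⊆ I}`. -/
def idealInverse {Λ : Subring A} (I : Submodule Λ A) : AddSubgroup A where
  carrier := {x | ∀ a ∈ I, ∀ b ∈ I, a * x * b ∈ I}
  zero_mem' := fun a _ b _ => by simp
  add_mem' := fun hx hy a ha b hb => by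
    rw [mul_add, add_mul]; exact I.add_mem (hx a ha b hb) (hy a ha b hb)
  neg_mem' := fun hx a ha b hb => by
    rw [mul_neg, neg_mul]; exact I.neg_mem (hx a ha b hb)

/-- `t · I⁻¹` and `J` are coprime: `t · I⁻¹ + J = Λ`. -/
def InverseCoprime {Λ : Subring A} (t : A) (I J : Submodule Λ A) : Prop :=
  (idealInverse I).map (AddMonoidHom.mulLeft t) ⊔ J.toAddSubgroup = Λ.toAddSubgroup

/-- The ideal `⟨q⟩ = q Λ` of `Λ` generated by the (central) integer `q`. -/
def principalIdeal (Λ : Subring A) (q : ℕ) : Submodule Λ A :=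
  Submodule.span Λ {(q : A)}

/-- For `t ∈ I ∩ K`, multiplication by `t` as a map `P → I P`. -/
noncomputable def mulCentral {Λ : Subring A} (I P : Submodule Λ A) (t : K)
    (ht : algebraMap K A t ∈ I) : P →ₗ[Λ] (I * P : Submodule Λ A) where
  toFun x := ⟨algebraMap K A t * (x : A), Submodule.mul_mem_mul ht x.2⟩
  map_add' x y := by ext; simp [mul_add]
  map_smul' r x := by
    ext
    simp only [SetLike.val_smul, Subring.smul_def, smul_eq_mul, RingHom.id_apply]
    rw [← mul_assoc, Algebra.commutes, mul_assoc]

/-- The homomorphism of left `Λ`-modules `χ_t : P / J P → I P / I J P` induced by `x ↦ t x`,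
for `t ∈ I ∩ K`. -/
noncomputable def chi {Λ : Subring A} (I J P : Submodule Λ A) (t : K)
    (ht : algebraMap K A t ∈ I) :
    (P ⧸ (J * P).submoduleOf P) →ₗ[Λ]
      ((I * P : Submodule Λ A) ⧸ (I * J * P).submoduleOf (I * P)) :=
  Submodule.mapQ _ _ (mulCentral I P t ht) fun x hx => by
    change (x : A) ∈ J * P at hx
    change algebraMap K A t * (x : A) ∈ I * J * P
    rw [mul_assoc]
    exact Submodule.mul_mem_mul ht hx

end Orders

/-! ### A machine model with logarithmic (bit) cost

Programs of a structured language over integer arrays, i.e. a random access machine with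
structured control flow. Every operation is charged according to the bit lengths of the integers
involved, as in the usual logarithmic cost criterion. -/

namespace BitCost

/-- The memory: cell `i` of array `a` holds the integer `s a i`. -/
abbrev Store : Type := ℕ → ℤ → ℤ

/-- The number of binary digits of `|z|`. -/
def bitLength (z : ℤ) : ℕ := z.natAbs.size

/-- Arithmetic operations of the machine; `div` and `mod` are integer division and remainder. -/
inductive Op
  | add | sub | mul | div | mod

/-- The result of an arithmetic operation. -/
def Op.apply : Op → ℤ → ℤ → ℤ
  | add, x, y => x + y
  | sub, x, y => x - y
  | mul, x, y => x * y
  | div, x, y => x / y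
  | mod, x, y => x % y

/-- Integer expressions: constants, array cells with a computed index, arithmetic. -/
inductive Expr
  | const (z : ℤ)
  | read (a : ℕ) (i : Expr)
  | op (o : Op) (x y : Expr)

/-- The value of an expression. -/
def Expr.eval (s : Store) : Expr → ℤ
  | const z => z
  | read a i => s a (i.eval s)
  | op o x y => o.apply (x.eval s) (y.eval s)

/-- The bit cost of evaluating an expression; an arithmetic operation on integers with `k` and `l`
digits costs `(k + 1) (l + 1)`. -/
def Expr.cost (s : Store) : Expr → ℕ
  | const z => bitLength z + 1
  | read a i => i.cost s + bitLength (i.eval s) + bitLength (s a (i.eval s)) + 1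
  | op _ x y => x.cost s + y.cost s + (bitLength (x.eval s) + 1) * (bitLength (y.eval s) + 1)

/-- Programs: do nothing, write `e` to cell `i` of array `a`, sequential composition, branching on
`0 < e`, and looping while `0 < e`. -/
inductive Prog
  | skip
  | write (a : ℕ) (i e : Expr)
  | seq (p r : Prog)
  | ite (e : Expr) (p r : Prog)
  | loop (e : Expr) (p : Prog)

/-- The memory after writing `z` to cell `i` of array `a`. -/
def Store.set (s : Store) (a : ℕ) (i z : ℤ) : Store :=
  Function.update s a (Function.update (s a) i z)

/-- `Run p s s' n`: started in memory `s`, the program `p` halts in memory `s'` at total cost `n`. -/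
inductive Run : Prog → Store → Store → ℕ → Prop
  | skip (s : Store) : Run .skip s s 1
  | write (a : ℕ) (i e : Expr) (s : Store) :
      Run (.write a i e) s (s.set a (i.eval s) (e.eval s))
        (i.cost s + e.cost s + bitLength (i.eval s) + bitLength (e.eval s) + 1)
  | seq {p r : Prog} {s s' s'' : Store} {m n : ℕ} :
      Run p s s' m → Run r s' s'' n → Run (.seq p r) s s'' (m + n + 1)
  | ite_pos {e : Expr} {p r : Prog} {s s' : Store} {n : ℕ} :
      0 < e.eval s → Run p s s' n → Run (.ite e p r) s s' (e.cost s + n + 1)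
  | ite_neg {e : Expr} {p r : Prog} {s s' : Store} {n : ℕ} :
      ¬ 0 < e.eval s → Run r s s' n → Run (.ite e p r) s s' (e.cost s + n + 1)
  | loop_done {e : Expr} {p : Prog} {s : Store} :
      ¬ 0 < e.eval s → Run (.loop e p) s s (e.cost s + 1)
  | loop_step {e : Expr} {p : Prog} {s s' s'' : Store} {m n : ℕ} :
      0 < e.eval s → Run p s s' m → Run (.loop e p) s' s'' n →
        Run (.loop e p) s s'' (e.cost s + m + n + 1)

/-- The initial memory: the `a`-th input list is written to cells `0, 1, 2, …` of array `a`, and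
all other cells are `0`. -/
def load (inp : List (List ℤ)) : Store := fun a i =>
  if 0 ≤ i then (inp.getD a []).getD i.toNat 0 else 0

/-- The length of the input: every list entry counts with its number of digits plus one. -/
def inputSize (inp : List (List ℤ)) : ℕ :=
  (inp.map fun l => (l.map fun z => bitLength z + 1).sum + 1).sum

end BitCost

/-! ### Inputs and outputs of the inversion problem -/

section Encoding

variable {K A : Type*} [Field K] [Ring A] [Algebra K A]

/-- The integers `den ≠ 0` and `v` describe `a ∈ A` with respect to a `ℤ`-basis `b` of `Λ`:
`a = (1 / den) ∑ i, v i • b i`. -/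
def Describes {Λ : Subring A} {N : ℕ} (b : Module.Basis (Fin N) ℤ Λ) (den : ℤ) (v : Fin N → ℤ)
    (a : A) : Prop :=
  den ≠ 0 ∧ den • a = ∑ i, v i • (b i : A)

/-- `den` and the rows of `M` describe a `ℤ`-basis of the additive group `P`. -/
def DescribesLattice {Λ : Subring A} {N : ℕ} (b : Module.Basis (Fin N) ℤ Λ) (den : ℤ)
    (M : Fin N → Fin N → ℤ) (P : Submodule Λ A) : Prop :=
  ∃ p : Fin N → A, (∀ i, Describes b den (M i) (p i)) ∧ LinearIndependent ℤ p ∧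
    AddSubgroup.closure (Set.range p) = P.toAddSubgroup

/-- An input of the inversion problem: the structure constants of `Λ`, `ℤ`-bases of `I` and `P`,
the prime `q`, the element `t` and a representative `y` of a class in `I P / q I P`. -/
structure InversionInput (N : ℕ) where
  table : Fin N → Fin N → Fin N → ℤ
  denI : ℤ
  matI : Fin N → Fin N → ℤ
  denP : ℤ
  matP : Fin N → Fin N → ℤ
  q : ℕ
  t : Fin N → ℤ
  denY : ℤ
  y : Fin N → ℤ

/-- The input as lists of integers. The indices of a matrix or of the table are combined into one,
row by row. -/
def InversionInput.encode {N : ℕ} (w : InversionInput N) : List (List ℤ) :=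
  [[(N : ℤ), (w.q : ℤ), w.denI, w.denP, w.denY],
   List.ofFn fun k : Fin (N * N * N) => w.table k.divNat.divNat k.divNat.modNat k.modNat,
   List.ofFn fun k : Fin (N * N) => w.matI k.divNat k.modNat,
   List.ofFn fun k : Fin (N * N) => w.matP k.divNat k.modNat,
   List.ofFn w.t,
   List.ofFn w.y]

/-- The input `w` describes the data `Λ, I, P, q, t, y` with respect to the `ℤ`-basis `b` of
`Λ`. -/
structure InversionInput.IsFor {Λ : Subring A} {N : ℕ} (w : InversionInput N)
    (b : Module.Basis (Fin N) ℤ Λ) (I P : Submodule Λ A) (q : ℕ) (t y : A) : Prop where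
  table : ∀ i j, b i * b j = ∑ k, w.table i j k • b k
  ideal : DescribesLattice b w.denI w.matI I
  fractional : DescribesLattice b w.denP w.matP P
  prime : w.q = q
  elt : Describes b 1 w.t t
  target : Describes b w.denY w.y y

/-- The final memory `s` holds `x ∈ A` in array `0`: cell `0` contains the denominator and cells
`1, …, N` the numerators of its coordinates. -/
def OutputDescribes {Λ : Subring A} {N : ℕ} (b : Module.Basis (Fin N) ℤ Λ) (s : BitCost.Store)
    (x : A) : Prop :=
  Describes b (s 0 0) (fun i => s 0 ((i : ℕ) + 1)) x

end Encoding

/-!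
The isomorphism. Let `t ≠ 0`; if `t = 0` then `J = Λ` and both quotients vanish. Since `t` is
central and lies in `I`, the left and right multiplier rings of `I`
are `ℤ`-orders containing `Λ` (multiplication by `t` moves them into `Λ`), so they equal `Λ` by
maximality, and hence `I I⁻¹` and `I⁻¹ I` are contained in `Λ`. Write `1 = t a + j` with `a ∈ I⁻¹`
and `j ∈ J`. Then `i p = t (i a) p + i j p` for `i ∈ I` and `p ∈ P`, which gives surjectivity, and
`x = a (t x) + j x`, which gives injectivity (`chi_bijective`). No commutativity of ideals is needed.

The algorithm. For `J = q Λ` the same relation gives `I ⊆ t Λ + q ^ e I` for all `e`. Hence, if an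
integer `D = q ^ e d` with `q ∤ d` is a multiple of `t` in `Λ`, then `d I P ⊆ t P`
(`InverseCoprime.exists_intCast_mul_eq`). For `g d ≡ 1` modulo `q` the element `x = g d t⁻¹ y`
therefore lies in `P`, and `t x - y = (g d - 1) y` lies in `q I P`. So inverting `χ_t` amounts to
finding an integer multiple `D` of `t` together with `D t⁻¹ y`; the bases of `I` and `P` are not
needed.

Up to sign, `D` is the determinant of multiplication by `t` on `Λ`. It is computed by the
Faddeev–LeVerrier iteration, a loop of fixed shape with exact divisions by small integers only.
Its correctness follows from comparing coefficients in
`(X - T) * adjugate (X - T) = charpoly T` and in `derivative (charpoly T) = trace (adjugate (X - T))`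
(Jacobi's formula); see `trace_leftMulMatrix_mul_hornerSeq` and `mul_hornerSeq_last`. The inverse of
`d` modulo `q` is `d ^ (q - 2)`, computed by repeated squaring.

The cost. If every memory cell holds at most `B` digits throughout and every loop is iterated at
most `m` times, then the cost of a program is bounded by a polynomial in `m` and `B` which depends
only on the program text (`BitCost.Prog.costBound`). A small program logic (`BitCost.Achieves`)
reduces the cost analysis to these two conditions. One step of the iteration multiplies the size of
the coordinates by at most a fixed power of `2 ^ n`, where `n` is the input size, and there are
fewer than `n` steps, so that `B` is quadratic in `n` (`wordSize`).
-/

/-! ### Bit lengths and costs of straight-line code -/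

namespace BitCost

theorem bitLength_le_iff {z : ℤ} {B : ℕ} : bitLength z ≤ B ↔ |z| < 2 ^ B := by
  rw [bitLength, Nat.size_le, Int.abs_eq_natAbs]
  exact_mod_cast Iff.rfl

theorem abs_lt_two_pow_bitLength (z : ℤ) : |z| < 2 ^ bitLength z :=
  bitLength_le_iff.1 le_rfl

theorem bitLength_mono {x y : ℤ} (h : |x| ≤ |y|) : bitLength x ≤ bitLength y :=
  bitLength_le_iff.2 (h.trans_lt (abs_lt_two_pow_bitLength y))

theorem bitLength_mul_le (x y : ℤ) : bitLength (x * y) ≤ bitLength x + bitLength y := by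
  rw [bitLength_le_iff, abs_mul, pow_add]
  exact mul_lt_mul'' (abs_lt_two_pow_bitLength x) (abs_lt_two_pow_bitLength y)
    (abs_nonneg _) (abs_nonneg _)

theorem bitLength_neg (x : ℤ) : bitLength (-x) = bitLength x := by simp [bitLength]

theorem bitLength_add_le (x y : ℤ) : bitLength (x + y) ≤ bitLength x + bitLength y + 1 := by
  rw [bitLength_le_iff]
  have hx := abs_lt_two_pow_bitLength x
  have hy := abs_lt_two_pow_bitLength y
  have h1 : (2 : ℤ) ^ bitLength x ≤ 2 ^ (bitLength x + bitLength y) :=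
    pow_le_pow_right₀ (by norm_num) (by omega)
  have h2 : (2 : ℤ) ^ bitLength y ≤ 2 ^ (bitLength x + bitLength y) :=
    pow_le_pow_right₀ (by norm_num) (by omega)
  have h3 := abs_add_le x y
  rw [pow_succ]
  linarith

theorem bitLength_ediv_le (x y : ℤ) : bitLength (x / y) ≤ bitLength x :=
  bitLength_mono (Int.abs_ediv_le_abs x y)

theorem bitLength_emod_le (x y : ℤ) : bitLength (x % y) ≤ bitLength x + bitLength y := by
  rcases eq_or_ne y 0 with rfl | hy
  · simp
  · refine (bitLength_mono (y := y) ?_).trans (Nat.le_add_left _ _)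
    rw [abs_of_nonneg (Int.emod_nonneg x hy)]
    exact (Int.emod_lt_abs x hy).le

theorem Op.bitLength_apply_le (o : Op) (x y : ℤ) :
    bitLength (o.apply x y) ≤ bitLength x + bitLength y + 1 := by
  cases o
  · exact bitLength_add_le x y
  · have := bitLength_add_le x (-y)
    rwa [bitLength_neg, ← sub_eq_add_neg] at this
  · exact (bitLength_mul_le x y).trans (Nat.le_succ _)
  · exact (bitLength_ediv_le x y).trans (by omega)
  · exact (bitLength_emod_le x y).trans (Nat.le_succ _)

/-- All cells of the memory hold integers with at most `B` binary digits. -/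
def Bounded (B : ℕ) (s : Store) : Prop := ∀ a i, bitLength (s a i) ≤ B

/-- The growth factor of an expression: in a memory with `B`-digit cells its value has at most
`weight * (B + 1)` digits. -/
def Expr.weight : Expr → ℕ
  | const z => bitLength z
  | read _ _ => 1
  | op _ x y => x.weight + y.weight + 1

theorem Expr.bitLength_eval_le {B : ℕ} {s : Store} (hs : Bounded B s) (e : Expr) :
    bitLength (e.eval s) ≤ e.weight * (B + 1) := by
  induction e with
  | const z => exact Nat.le_mul_of_pos_right _ (Nat.succ_pos B)
  | read a i => exact (hs a _).trans (by simp [weight])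
  | op o x y hx hy =>
    refine (o.bitLength_apply_le _ _).trans ?_
    simp only [weight, add_mul]
    omega

/-- A bound for the cost of evaluating an expression in a memory with `B`-digit cells. It is defined
over any semiring, so that it can be evaluated at a number as well as at a polynomial. -/
def Expr.costBound {R : Type*} [CommSemiring R] (B : R) : Expr → R
  | const z => bitLength z + 1
  | read _ i => i.costBound B + i.weight * (B + 1) + B + 1
  | op _ x y => x.costBound B + y.costBound B +
      (x.weight * (B + 1) + 1) * (y.weight * (B + 1) + 1)

theorem Expr.cost_le {B : ℕ} {s : Store} (hs : Bounded B s) (e : Expr) :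
    e.cost s ≤ e.costBound B := by
  induction e with
  | const z => exact le_rfl
  | read a i hi =>
    simp only [cost, costBound]
    gcongr
    · exact i.bitLength_eval_le hs
    · exact hs _ _
  | op o x y hx hy =>
    simp only [cost, costBound]
    gcongr
    · exact x.bitLength_eval_le hs
    · exact y.bitLength_eval_le hs

theorem Expr.map_costBound {R S : Type*} [CommSemiring R] [CommSemiring S] (f : R →+* S) (B : R)
    (e : Expr) : f (e.costBound B) = e.costBound (f B) := by
  induction e with
  | const z => simp [costBound]
  | read a i hi => simp [costBound, hi]
  | op o x y hx hy => simp [costBound, hx, hy]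

/-- A bound for the cost of a program all of whose loops are iterated at most `m` times, in
memories with `B`-digit cells. -/
def Prog.costBound {R : Type*} [CommSemiring R] (m B : R) : Prog → R
  | skip => 1
  | write _ i e => i.costBound B + e.costBound B + i.weight * (B + 1) + e.weight * (B + 1) + 1
  | seq p r => p.costBound m B + r.costBound m B + 1
  | ite e p r => e.costBound B + p.costBound m B + r.costBound m B + 1
  | loop e p => (m + 1) * (e.costBound B + p.costBound m B + 1)

theorem Prog.map_costBound {R S : Type*} [CommSemiring R] [CommSemiring S] (f : R →+* S) (m B : R)
    (p : Prog) : f (p.costBound m B) = p.costBound (f m) (f B) := by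
  induction p with
  | skip => simp [costBound]
  | write a i e => simp [costBound, Expr.map_costBound]
  | seq p r hp hr => simp [costBound, hp, hr]
  | ite e p r hp hr => simp [costBound, hp, hr, Expr.map_costBound]
  | loop e p hp => simp [costBound, hp, Expr.map_costBound]

/-! ### A program logic for total correctness within the cost bound -/

theorem set_same (s : Store) (a : ℕ) (i z : ℤ) :
    (s.set a i z) a = Function.update (s a) i z := by
  simp [Store.set]

theorem set_of_ne (s : Store) {a b : ℕ} (h : b ≠ a) (i z : ℤ) : (s.set a i z) b = s b := by
  simp [Store.set, h]

/-- Total correctness within resources: from memory `s` the program `p` halts within its cost bound,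
in a memory with `B`-digit cells that satisfies `Q`. -/
def Achieves (m B : ℕ) (p : Prog) (s : Store) (Q : Store → Prop) : Prop :=
  ∃ s' c, Run p s s' c ∧ c ≤ p.costBound m B ∧ Bounded B s' ∧ Q s'

section Rules

variable {m B : ℕ} {s : Store} {Q R : Store → Prop}

theorem Achieves.mono {p : Prog} (h : Achieves m B p s Q)
    (hQ : ∀ s', Bounded B s' → Q s' → R s') : Achieves m B p s R := by
  obtain ⟨s', c, h1, h2, h3, h4⟩ := h
  exact ⟨s', c, h1, h2, h3, hQ s' h3 h4⟩

theorem Bounded.set (hs : Bounded B s) {a : ℕ} {i z : ℤ} (hz : bitLength z ≤ B) :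
    Bounded B (s.set a i z) := by
  intro b j
  rcases eq_or_ne b a with rfl | hb
  · rw [set_same, Function.update_apply]
    split_ifs
    exacts [hz, hs b j]
  · rw [set_of_ne s hb]
    exact hs b j

theorem achieves_write (hs : Bounded B s) {a : ℕ} {i e : Expr} (he : bitLength (e.eval s) ≤ B)
    (hQ : Q (s.set a (i.eval s) (e.eval s))) : Achieves m B (.write a i e) s Q := by
  refine ⟨_, _, Run.write a i e s, ?_, hs.set he, hQ⟩
  simp only [Prog.costBound]
  gcongr
  · exact i.cost_le hs
  · exact e.cost_le hs
  · exact i.bitLength_eval_le hs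
  · exact e.bitLength_eval_le hs

theorem achieves_seq {p r : Prog} (hp : Achieves m B p s R)
    (hr : ∀ s', Bounded B s' → R s' → Achieves m B r s' Q) : Achieves m B (.seq p r) s Q := by
  obtain ⟨s', c, h1, h2, h3, h4⟩ := hp
  obtain ⟨s'', d, k1, k2, k3, k4⟩ := hr s' h3 h4
  refine ⟨s'', _, Run.seq h1 k1, ?_, k3, k4⟩
  simp only [Prog.costBound]
  omega

/-- The rule for a loop that is iterated `n` times, with invariant `J k` after `k` iterations. -/
theorem achieves_loop {e : Expr} {p : Prog} {n : ℕ} (hn : n ≤ m) (J : ℕ → Store → Prop)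
    (hs : Bounded B s) (h0 : J 0 s)
    (hstep : ∀ k < n, ∀ s', Bounded B s' → J k s' →
      0 < e.eval s' ∧ Achieves m B p s' (J (k + 1)))
    (hdone : ∀ s', Bounded B s' → J n s' → ¬ 0 < e.eval s') :
    Achieves m B (.loop e p) s (J n) := by
  suffices H : ∀ l k, k + l = n → ∀ s, Bounded B s → J k s →
      ∃ s' c, Run (.loop e p) s s' c ∧ c ≤ (l + 1) * (e.costBound B + p.costBound m B + 1) ∧
        Bounded B s' ∧ J n s' by
    obtain ⟨s', c, h1, h2, h3⟩ := H n 0 (zero_add n) s hs h0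
    refine ⟨s', c, h1, h2.trans ?_, h3⟩
    simp only [Prog.costBound]
    gcongr
  intro l
  induction l with
  | zero =>
    rintro k rfl s hs hk
    refine ⟨s, _, Run.loop_done (hdone s hs hk), ?_, hs, hk⟩
    have := e.cost_le hs
    simp only [zero_add, one_mul]
    omega
  | succ l ih =>
    intro k hk s hs hJ
    obtain ⟨he, s', c, h1, h2, h3, h4⟩ := hstep k (by omega) s hs hJ
    obtain ⟨s'', d, k1, k2, k3, k4⟩ := ih (k + 1) (by omega) s' h3 h4
    refine ⟨s'', _, Run.loop_step he h1 k1, ?_, k3, k4⟩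
    have := e.cost_le hs
    rw [add_mul (l + 1)]
    omega

end Rules

/-! ### Scalar variables and counting loops -/

/-- The scalar variable `a`, stored in cell `0` of array `a`. -/
abbrev Expr.var (a : ℕ) : Expr := .read a (.const 0)

/-- Assignment to a scalar variable. -/
abbrev Prog.assign (a : ℕ) (e : Expr) : Prog := .write a (.const 0) e

/-- The loop `for c = 0, …, bnd - 1 do p`. -/
def Prog.for (c : ℕ) (bnd : Expr) (p : Prog) : Prog :=
  .seq (.assign c (.const 0))
    (.loop (.op .sub bnd (.var c)) (.seq p (.assign c (.op .add (.var c) (.const 1)))))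

theorem achieves_for {m B n c : ℕ} {s : Store} {bnd : Expr} {p : Prog} (hn : n ≤ m)
    (hB : bitLength n ≤ B) (J : ℕ → Store → Prop) (hs : Bounded B s)
    -- the invariant does not mention the counter
    (hJ : ∀ k s z, J k s → J k (s.set c 0 z))
    (hbnd : ∀ k s, J k s → bnd.eval s = n)
    (h0 : J 0 s)
    (hstep : ∀ k < n, ∀ s', Bounded B s' → s' c 0 = k → J k s' →
      Achieves m B p s' fun s'' => s'' c 0 = k ∧ J (k + 1) s'') :
    Achieves m B (.for c bnd p) s (J n) := by
  refine achieves_seq (R := fun s' => s' c 0 = (0 : ℕ) ∧ J 0 s')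
    (achieves_write hs (by simp [Expr.eval, bitLength]) ⟨?_, hJ _ _ _ h0⟩) ?_
  · simp [set_same, Expr.eval]
  · rintro s hs h
    refine (achieves_loop hn (fun k s => s c 0 = k ∧ J k s) hs h ?_ ?_).mono fun _ _ h => h.2
    · rintro k hk s' hs' ⟨hc, hJs⟩
      refine ⟨?_, achieves_seq (hstep k hk s' hs' hc hJs) ?_⟩
      · simp only [Expr.eval, Op.apply, hbnd _ _ hJs, hc]
        omega
      · rintro s'' hs'' ⟨hc', hJ'⟩
        have hev : (Expr.op .add (.var c) (.const 1)).eval s'' = ((k + 1 : ℕ) : ℤ) := by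
          simp [Expr.eval, Op.apply, hc']
        refine achieves_write hs'' ?_ ⟨?_, hJ _ _ _ hJ'⟩
        · rw [hev]
          refine le_trans (bitLength_mono ?_) hB
          simp only [Nat.abs_cast]
          exact_mod_cast hk
        · rw [hev, set_same]
          simp [Expr.eval]
    · rintro s' hs' ⟨hc, hJs⟩
      simp [Expr.eval, Op.apply, hbnd _ _ hJs, hc]

/-- A counting loop whose body writes to the single array `a`: the contents of `a` run through the
sequence `F`, and all other arrays except the counter keep their contents. -/
theorem achieves_for_write {m B n c a : ℕ} {s : Store} {bnd i e : Expr} (hn : n ≤ m)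
    (hB : bitLength n ≤ B) (hac : a ≠ c) (F : ℕ → ℤ → ℤ) (hs : Bounded B s)
    (h0 : F 0 = s a)
    (hbnd : ∀ s' : Store, (∀ x, x ≠ a → x ≠ c → s' x = s x) → bnd.eval s' = n)
    (hstep : ∀ k < n, ∀ s' : Store, s' c 0 = k → s' a = F k →
      (∀ x, x ≠ a → x ≠ c → s' x = s x) →
      F (k + 1) = Function.update (F k) (i.eval s') (e.eval s') ∧ bitLength (e.eval s') ≤ B) :
    Achieves m B (.for c bnd (.write a i e)) s
      fun s' => s' a = F n ∧ ∀ x, x ≠ a → x ≠ c → s' x = s x := by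
  refine achieves_for hn hB (fun k s' => s' a = F k ∧ ∀ x, x ≠ a → x ≠ c → s' x = s x) hs
    ?_ ?_ ⟨h0.symm, fun _ _ _ => rfl⟩ ?_
  · rintro k s' z ⟨h1, h2⟩
    refine ⟨by rw [set_of_ne _ hac, h1], fun x hx hxc => by rw [set_of_ne _ hxc, h2 x hx hxc]⟩
  · exact fun k s' h => hbnd s' h.2
  · rintro k hk s' hs' hc ⟨h1, h2⟩
    obtain ⟨h3, h4⟩ := hstep k hk s' hc h1 h2
    refine achieves_write hs' h4 ⟨by rw [set_of_ne _ hac.symm, hc], ?_, ?_⟩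
    · rw [set_same, h1, h3]
    · exact fun x hx hxc => by rw [set_of_ne _ hx, h2 x hx hxc]

end BitCost

/-! ### Arithmetic with coordinate vectors on the machine -/

namespace BitCost

/-- The `i`-th coordinate of the product of the vectors `t` and `v` with respect to the structure
constants `tab`, which are indexed by `r = (r / N / N, r / N % N, r % N)`; only the first `L`
structure constants are taken into account. -/
def partialMul (N : ℕ) (t v tab : ℕ → ℤ) (L i : ℕ) : ℤ :=
  ∑ r ∈ Finset.range L, if r % N = i then t (r / N / N) * v (r / N % N) * tab r else 0

/-- The first `L` terms of the trace `∑ i, ∑ j, v i * tab (i, j, j)` of multiplication by the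
vector `v`; the pair `(i, j)` is encoded as `r = i * N + j`. -/
def partialTrace (N : ℕ) (v tab : ℕ → ℤ) (L : ℕ) : ℤ :=
  ∑ r ∈ Finset.range L, v (r / N) * tab (r * N + r % N)

theorem partialMul_congr {N : ℕ} {t v v' tab : ℕ → ℤ} {L i : ℕ}
    (h : ∀ j < N, v j = v' j) (hN : 0 < N) :
    partialMul N t v tab L i = partialMul N t v' tab L i := by
  refine Finset.sum_congr rfl fun r _ => ?_
  rw [h _ (Nat.mod_lt _ hN)]

theorem partialTrace_congr {N : ℕ} {v v' tab : ℕ → ℤ} {L : ℕ}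
    (h : ∀ j < N, v j = v' j) (hL : L ≤ N * N) :
    partialTrace N v tab L = partialTrace N v' tab L := by
  refine Finset.sum_congr rfl fun r hr => ?_
  rw [h _ (Nat.div_lt_of_lt_mul ((Finset.mem_range.1 hr).trans_le hL))]

theorem abs_partialMul_le {N : ℕ} {t v tab : ℕ → ℤ} {L i : ℕ} {a b c : ℤ}
    (hN : 0 < N) (hL : L ≤ N * N * N) (ht : ∀ j < N, |t j| ≤ a) (hv : ∀ j < N, |v j| ≤ b)
    (htab : ∀ j < N * N * N, |tab j| ≤ c) :
    |partialMul N t v tab L i| ≤ L * (a * b * c) := by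
  have ha : 0 ≤ a := (abs_nonneg _).trans (ht 0 hN)
  have hb : 0 ≤ b := (abs_nonneg _).trans (hv 0 hN)
  have hc : 0 ≤ c := (abs_nonneg _).trans (htab 0 (by positivity))
  refine (Finset.abs_sum_le_sum_abs _ _).trans ?_
  refine (Finset.sum_le_card_nsmul _ _ (a * b * c) fun r hr => ?_).trans_eq (by simp)
  have hr' : r < N * N * N := (Finset.mem_range.1 hr).trans_le hL
  split_ifs
  · rw [abs_mul, abs_mul]
    gcongr
    · refine ht _ (Nat.div_lt_of_lt_mul (Nat.div_lt_of_lt_mul ?_))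
      rwa [← mul_assoc]
    · exact hv _ (Nat.mod_lt _ hN)
    · exact htab _ hr'
  · rw [abs_zero]
    positivity

theorem abs_partialTrace_le {N : ℕ} {v tab : ℕ → ℤ} {L : ℕ} {b c : ℤ}
    (hN : 0 < N) (hL : L ≤ N * N) (hv : ∀ j < N, |v j| ≤ b)
    (htab : ∀ j < N * N * N, |tab j| ≤ c) :
    |partialTrace N v tab L| ≤ L * (b * c) := by
  have hb : 0 ≤ b := (abs_nonneg _).trans (hv 0 hN)
  refine (Finset.abs_sum_le_sum_abs _ _).trans ?_
  refine (Finset.sum_le_card_nsmul _ _ (b * c) fun r hr => ?_).trans_eq (by simp)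
  have hr' : r < N * N := (Finset.mem_range.1 hr).trans_le hL
  rw [abs_mul]
  refine mul_le_mul (hv _ (Nat.div_lt_of_lt_mul hr')) (htab _ ?_) (abs_nonneg _) hb
  calc r * N + r % N < r * N + N := by gcongr; exact Nat.mod_lt _ hN
    _ = (r + 1) * N := by ring
    _ ≤ N * N * N := by gcongr; exact hr'

/-- Copy the first `N` cells of array `src` to array `dst`. The dimension `N` is stored in the
variable `10`, and the variable `15` is the counter. -/
def copyProg (src dst : ℕ) : Prog :=
  .for 15 (.var 10) (.write dst (.var 15) (.read src (.var 15)))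

/-- Replace the vector `v` in array `dst` by `t * v + c * w`, where `w` is the vector in array
`orig`, `t` is the vector in array `4`, and `c` is the variable `14`. The structure constants are
in array `1`; array `8` and the variable `15` are overwritten. -/
def mulAddProg (dst orig : ℕ) : Prog :=
  .seq (.for 15 (.var 10) (.write 8 (.var 15) (.op .mul (.var 14) (.read orig (.var 15)))))
  (.seq
    (.for 15 (.op .mul (.op .mul (.var 10) (.var 10)) (.var 10))
      (.write 8 (.op .mod (.var 15) (.var 10))
        (.op .add (.read 8 (.op .mod (.var 15) (.var 10)))
          (.op .mul
            (.op .mul (.read 4 (.op .div (.op .div (.var 15) (.var 10)) (.var 10)))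
              (.read dst (.op .mod (.op .div (.var 15) (.var 10)) (.var 10))))
            (.read 1 (.var 15))))))
    (copyProg 8 dst))

/-- Store the trace of multiplication by the vector in array `6` in the variable `16`. -/
def traceProg : Prog :=
  .seq (.assign 16 (.const 0))
    (.for 15 (.op .mul (.var 10) (.var 10))
      (.assign 16 (.op .add (.var 16)
        (.op .mul (.read 6 (.op .div (.var 15) (.var 10)))
          (.read 1 (.op .add (.op .mul (.var 15) (.var 10)) (.op .mod (.var 15) (.var 10))))))))

/-- The first `k` cells of `g` are overwritten by the values `f`. -/
def overwrite (f : ℕ → ℤ) (g : ℤ → ℤ) (k : ℕ) : ℤ → ℤ :=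
  fun i => if 0 ≤ i ∧ i < k then f i.toNat else g i

theorem overwrite_zero (f : ℕ → ℤ) (g : ℤ → ℤ) : overwrite f g 0 = g := by
  funext i
  rw [overwrite, if_neg]
  push_cast
  omega

theorem overwrite_succ (f : ℕ → ℤ) (g : ℤ → ℤ) (k : ℕ) :
    overwrite f g (k + 1) = Function.update (overwrite f g k) k (f k) := by
  funext i
  rw [Function.update_apply]
  split_ifs with h
  · subst h
    simp [overwrite]
  · simp only [overwrite]
    refine if_congr ?_ rfl rfl
    push_cast
    omega

theorem overwrite_apply {f : ℕ → ℤ} {g : ℤ → ℤ} {k i : ℕ} (h : i < k) :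
    overwrite f g k i = f i := by
  simp [overwrite, h]

section

variable {m B N : ℕ} {s : Store}

theorem achieves_copyProg {src dst : ℕ} (hs : Bounded B s) (hN : s 10 0 = N) (hm : N ≤ m)
    (hB : bitLength N ≤ B) (hd : dst ≠ 10) (hd' : dst ≠ 15) (hsd : src ≠ dst) (hs' : src ≠ 15) :
    Achieves m B (copyProg src dst) s fun s' =>
      (∀ i < N, s' dst (i : ℕ) = s src (i : ℕ)) ∧ ∀ x, x ≠ dst → x ≠ 15 → s' x = s x := by
  refine (achieves_for_write hm hB hd' (overwrite (fun i => s src i) (s dst)) hs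
    (overwrite_zero _ _) ?_ ?_).mono ?_
  · intro s' h
    simp only [Expr.eval, h 10 hd.symm (by decide), hN]
  · intro k hk s' hc _ h
    simp only [Expr.eval, hc, h src hsd hs']
    exact ⟨overwrite_succ _ _ _, hs _ _⟩
  · rintro s' - ⟨h1, h2⟩
    exact ⟨fun i hi => by rw [h1, overwrite_apply hi], h2⟩

theorem achieves_mulAddProg {dst orig : ℕ} (hs : Bounded B s) (hN : s 10 0 = N) (hpos : 0 < N)
    (hm : N * N * N ≤ m) (hB : bitLength (N * N * N : ℕ) ≤ B)
    (hd8 : dst ≠ 8) (hd10 : dst ≠ 10) (hd15 : dst ≠ 15) (ho8 : orig ≠ 8) (ho15 : orig ≠ 15)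
    (hbd : ∀ i < N, ∀ L ≤ N * N * N, bitLength (s 14 0 * s orig (i : ℕ) +
      partialMul N (fun i => s 4 i) (fun i => s dst i) (fun i => s 1 i) L i) ≤ B) :
    Achieves m B (mulAddProg dst orig) s fun s' =>
      (∀ i < N, s' dst (i : ℕ) =
        partialMul N (fun i => s 4 i) (fun i => s dst i) (fun i => s 1 i) (N * N * N) i +
          s 14 0 * s orig (i : ℕ)) ∧
      ∀ x, x ≠ 8 → x ≠ dst → x ≠ 15 → s' x = s x := by
  have hle : N ≤ N * N * N := Nat.le_mul_of_pos_left N (by positivity)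
  have hBN : bitLength N ≤ B := by
    refine le_trans (bitLength_mono ?_) hB
    simp only [Nat.abs_cast]
    exact_mod_cast hle
  refine achieves_seq (achieves_for_write (hle.trans hm) hBN (by decide)
    (overwrite (fun i => s 14 0 * s orig i) (s 8)) hs (overwrite_zero _ _) ?_ ?_) ?_
  · intro s' h
    simp only [Expr.eval, h 10 (by decide) (by decide), hN]
  · intro k hk s' hc _ h
    simp only [Expr.eval, Op.apply, hc, h 14 (by decide) (by decide), h orig ho8 ho15]
    exact ⟨overwrite_succ _ _ _, by simpa [partialMul] using hbd k hk 0 (Nat.zero_le _)⟩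
  rintro s1 hs1 ⟨h8, h1⟩
  have hN1 : s1 10 0 = N := by rw [h1 10 (by decide) (by decide), hN]
  refine achieves_seq (achieves_for_write hm hB (by decide)
    (fun L => overwrite (fun i => s 14 0 * s orig i +
      partialMul N (fun i => s 4 i) (fun i => s dst i) (fun i => s 1 i) L i) (s 8) N) hs1 ?_ ?_ ?_)
    ?_
  · rw [h8]
    simp [partialMul]
  · intro s' h
    simp only [Expr.eval, Op.apply, h 10 (by decide) (by decide), hN1]
    push_cast
    rfl
  · intro k hk s' hc h8' h
    have hkN : k % N < N := Nat.mod_lt _ hpos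
    simp only [Expr.eval, Op.apply, hc, h 10 (by decide) (by decide), hN1, h8', h dst hd8 hd15,
      h1 dst hd8 hd15, h 4 (by decide) (by decide), h 1 (by decide) (by decide),
      h1 4 (by decide) (by decide), h1 1 (by decide) (by decide)]
    rw [← Int.natCast_mod, ← Int.natCast_div, ← Int.natCast_div, ← Int.natCast_mod,
      overwrite_apply hkN]
    have hval : s 14 0 * s orig ((k % N : ℕ) : ℤ) +
        partialMul N (fun i => s 4 i) (fun i => s dst i) (fun i => s 1 i) k (k % N) +
          s 4 ((k / N / N : ℕ) : ℤ) * s dst ((k / N % N : ℕ) : ℤ) * s 1 k =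
        s 14 0 * s orig ((k % N : ℕ) : ℤ) +
        partialMul N (fun i => s 4 i) (fun i => s dst i) (fun i => s 1 i) (k + 1) (k % N) := by
      rw [partialMul, partialMul, Finset.sum_range_succ, if_pos rfl, add_assoc]
    rw [hval]
    refine ⟨?_, hbd _ hkN _ hk⟩
    funext i
    rw [Function.update_apply]
    split_ifs with hi
    · rw [hi, overwrite_apply hkN]
    · simp only [overwrite]
      split_ifs with hi'
      · congr 1
        rw [partialMul, partialMul, Finset.sum_range_succ, if_neg, add_zero]
        omega
      · rfl
  rintro s2 hs2 ⟨h8', h2⟩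
  have hN2 : s2 10 0 = N := by rw [h2 10 (by decide) (by decide), hN1]
  refine (achieves_copyProg hs2 hN2 (hle.trans hm) hBN hd10 hd15 hd8.symm (by decide)).mono ?_
  rintro s3 - ⟨h3, h3'⟩
  refine ⟨fun i hi => ?_, fun x hx hxd hx15 => ?_⟩
  · rw [h3 i hi, h8', overwrite_apply hi, add_comm]
  · rw [h3' x hxd hx15, h2 x hx hx15, h1 x hx hx15]

theorem achieves_traceProg (hs : Bounded B s) (hN : s 10 0 = N)
    (hm : N * N ≤ m) (hB : bitLength (N * N : ℕ) ≤ B)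
    (hbd : ∀ L ≤ N * N, bitLength (partialTrace N (fun i => s 6 i) (fun i => s 1 i) L) ≤ B) :
    Achieves m B traceProg s fun s' =>
      s' 16 0 = partialTrace N (fun i => s 6 i) (fun i => s 1 i) (N * N) ∧
      ∀ x, x ≠ 16 → x ≠ 15 → s' x = s x := by
  refine achieves_seq (R := fun s' => s' = s.set 16 0 0)
    (achieves_write hs (by simp [Expr.eval, bitLength]) rfl) ?_
  rintro s1 hs1 rfl
  have h1 : ∀ x, x ≠ 16 → s.set 16 0 0 x = s x := fun x hx => set_of_ne s hx 0 0
  refine (achieves_for_write hm hB (by decide) (fun L => Function.update (s 16) 0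
    (partialTrace N (fun i => s 6 i) (fun i => s 1 i) L)) hs1 ?_ ?_ ?_).mono ?_
  · simp [partialTrace, set_same]
  · intro s' h
    simp only [Expr.eval, Op.apply, h 10 (by decide) (by decide), h1 10 (by decide), hN]
    push_cast
    rfl
  · intro k hk s' hc h16 h
    simp only [Expr.eval, Op.apply, hc, h16, h 10 (by decide) (by decide), h1 10 (by decide), hN,
      h 6 (by decide) (by decide), h1 6 (by decide), h 1 (by decide) (by decide),
      h1 1 (by decide), Function.update_self]
    have hval : partialTrace N (fun i => s 6 i) (fun i => s 1 i) k +
        s 6 ((k : ℤ) / (N : ℤ)) * s 1 ((k : ℤ) * (N : ℤ) + (k : ℤ) % (N : ℤ)) =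
        partialTrace N (fun i => s 6 i) (fun i => s 1 i) (k + 1) := by
      rw [partialTrace, partialTrace, Finset.sum_range_succ]
      push_cast
      rfl
    rw [hval, Function.update_idem]
    exact ⟨rfl, hbd _ hk⟩
  · rintro s' - ⟨h16, h⟩
    refine ⟨by rw [h16, Function.update_self], fun x hx hx' => by rw [h x hx hx', h1 x hx]⟩

end

end BitCost

/-! ### Splitting off a prime power and inverting modulo a prime -/

namespace BitCost

/-- Write the variable `17` as `q ^ e * d` with `q ∤ d`, where `q` is the variable `11`. Afterwards
the variable `17` is `d` and the variable `18` is `q ^ e`. -/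
def stripProg : Prog :=
  .seq (.assign 18 (.const 1))
    -- the remainder is nonnegative, so the guard is positive exactly if `q` divides the variable `17`
    (.loop (.op .sub (.const 1) (.op .mod (.var 17) (.var 11)))
      (.seq (.assign 17 (.op .div (.var 17) (.var 11)))
        (.assign 18 (.op .mul (.var 18) (.var 11)))))

/-- Store in the variable `21` an inverse of the variable `17` modulo the prime `q` in the variable
`11`, namely its `(q - 2)`-th power, by repeated squaring. -/
def invProg : Prog :=
  .seq (.assign 20 (.op .mod (.var 17) (.var 11)))
  (.seq (.assign 19 (.op .sub (.var 11) (.const 2)))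
  (.seq (.assign 21 (.const 1))
    (.loop (.var 19)
      (.seq
        -- multiply by the base if the exponent is odd, and by `1` otherwise
        (.assign 21 (.op .mod (.op .mul (.var 21) (.op .add (.const 1)
          (.op .mul (.op .mod (.var 19) (.const 2)) (.op .sub (.var 20) (.const 1))))) (.var 11)))
      (.seq (.assign 20 (.op .mod (.op .mul (.var 20) (.var 20)) (.var 11)))
        (.assign 19 (.op .div (.var 19) (.const 2))))))))

theorem set_var_self (s : Store) (a : ℕ) (z : ℤ) : s.set a 0 z a 0 = z := by
  simp [Store.set]

variable {m B : ℕ} {s : Store}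

theorem achieves_stripProg {q : ℕ} {D : ℤ} (hs : Bounded B s) (hm : B ≤ m) (hq : 2 ≤ q)
    (hD : D ≠ 0) (h17 : s 17 0 = D) (h11 : s 11 0 = q) :
    Achieves m B stripProg s fun s' =>
      ∃ (e : ℕ) (d : ℤ), D = q ^ e * d ∧ ¬ (q : ℤ) ∣ d ∧ s' 17 0 = d ∧ s' 18 0 = q ^ e ∧
        ∀ x, x ∉ [17, 18] → s' x = s x := by
  have hq0 : (0 : ℤ) < q := by exact_mod_cast (by omega : 0 < q)
  have hfin : FiniteMultiplicity (q : ℤ) D :=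
    Int.finiteMultiplicity_iff.2 ⟨by simp only [Int.natAbs_natCast]; omega, hD⟩
  obtain ⟨d, hd, hqd⟩ := hfin.exists_eq_pow_mul_and_not_dvd
  generalize multiplicity (q : ℤ) D = e at hd
  have hd0 : d ≠ 0 := by rintro rfl; simp at hqd
  have hD' : |D| < 2 ^ B := bitLength_le_iff.1 (h17 ▸ hs 17 0)
  have hd1 : 1 ≤ |d| := Int.one_le_abs hd0
  have hle : ∀ k ≤ e, |(q : ℤ) ^ k| ≤ |D| ∧ |(q : ℤ) ^ k * d| ≤ |D| := by
    intro k hk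
    have h1 : (q : ℤ) ^ k ≤ q ^ e := pow_le_pow_right₀ (by omega) hk
    rw [hd, abs_mul, abs_mul, abs_of_pos (pow_pos hq0 k), abs_of_pos (pow_pos hq0 e)]
    constructor
    · calc (q : ℤ) ^ k ≤ q ^ e * 1 := by rwa [mul_one]
        _ ≤ _ := by gcongr
    · gcongr
  have hBle : ∀ {z : ℤ}, |z| ≤ |D| → bitLength z ≤ B := fun h => bitLength_le_iff.2 (h.trans_lt hD')
  have he : e ≤ B := by
    by_contra! h
    have h1 : (2 : ℤ) ^ B ≤ 2 ^ e := pow_le_pow_right₀ (by norm_num) h.le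
    have h2 : (2 : ℤ) ^ e ≤ q ^ e := by gcongr; exact_mod_cast hq
    have h3 := (hle e le_rfl).1
    rw [abs_of_pos (pow_pos hq0 e)] at h3
    omega
  refine achieves_seq (R := fun s' => s' 18 0 = 1 ∧ ∀ x, x ≠ 18 → s' x = s x)
    (achieves_write hs ?_ ⟨by simp [Expr.eval, set_var_self], fun x hx => set_of_ne s hx _ _⟩) ?_
  · refine hBle ?_
    simpa [Expr.eval] using Int.one_le_abs hD
  rintro s1 hs1 ⟨h18, h1⟩
  refine (achieves_loop (he.trans hm) (fun k s' => s' 17 0 = q ^ (e - k) * d ∧ s' 18 0 = q ^ k ∧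
    ∀ x, x ∉ [17, 18] → s' x = s x) hs1 ⟨?_, ?_, ?_⟩ ?_ ?_).mono ?_
  · rw [h1 17 (by decide), h17, hd, Nat.sub_zero]
  · simpa using h18
  · exact fun x hx => h1 x fun h => hx (by simp [h])
  · rintro k hk s2 hs2 ⟨k17, k18, k1⟩
    have k11 : s2 11 0 = q := by rw [k1 11 (by decide), h11]
    have hsplit : (q : ℤ) ^ (e - k) * d = q * (q ^ (e - (k + 1)) * d) := by
      rw [show e - k = e - (k + 1) + 1 by omega, pow_succ]
      ring
    constructor
    · simp only [Expr.eval, Op.apply, k17, k11, hsplit, Int.mul_emod_right]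
      norm_num
    · have hev : (Expr.op .div (.var 17) (.var 11)).eval s2 = q ^ (e - (k + 1)) * d := by
        simp only [Expr.eval, Op.apply, k17, k11, hsplit]
        exact Int.mul_ediv_cancel_left _ hq0.ne'
      refine achieves_seq (R := fun s' => s' 17 0 = q ^ (e - (k + 1)) * d ∧
        ∀ x, x ≠ 17 → s' x = s2 x) (achieves_write hs2 ?_ ⟨?_, fun x hx => set_of_ne s2 hx _ _⟩) ?_
      · rw [hev]
        exact hBle (hle _ (by omega)).2
      · rw [hev]
        exact set_var_self _ _ _
      · rintro s3 hs3 ⟨l17, l1⟩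
        have hev' : (Expr.op .mul (.var 18) (.var 11)).eval s3 = q ^ (k + 1) := by
          simp only [Expr.eval, Op.apply, l1 18 (by decide), l1 11 (by decide), k18, k11, pow_succ]
        refine achieves_write hs3 ?_ ⟨?_, ?_, fun x hx => ?_⟩
        · rw [hev']
          exact hBle (hle _ hk).1
        · rw [set_of_ne _ (by decide), l17]
        · rw [hev']
          exact set_var_self _ _ _
        · rw [set_of_ne _ fun h => hx (by simp [h]), l1 x fun h => hx (by simp [h]), k1 x hx]
  · rintro s2 - ⟨k17, -, k1⟩
    have k11 : s2 11 0 = q := by rw [k1 11 (by decide), h11]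
    simp only [Expr.eval, Op.apply, k17, k11, Nat.sub_self, pow_zero, one_mul]
    have h1 := Int.emod_nonneg d hq0.ne'
    have h2 : d % q ≠ 0 := fun h => hqd (Int.dvd_of_emod_eq_zero h)
    omega
  · rintro s2 - ⟨k17, k18, k1⟩
    exact ⟨e, d, hd, hqd, by simpa using k17, k18, k1⟩

theorem achieves_invProg {q : ℕ} {d : ℤ} (hs : Bounded B s) (hm : B ≤ m) (hq : q.Prime)
    (hqd : ¬ (q : ℤ) ∣ d) (h17 : s 17 0 = d) (h11 : s 11 0 = q) :
    Achieves m B invProg s fun s' =>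
      |s' 21 0| ≤ q ∧ (q : ℤ) ∣ s' 21 0 * d - 1 ∧ ∀ x, x ∉ [19, 20, 21] → s' x = s x := by
  have hq2 := hq.two_le
  have hq0 : (0 : ℤ) < q := by exact_mod_cast hq.pos
  have hqB : |(q : ℤ)| < 2 ^ B := bitLength_le_iff.1 (h11 ▸ hs 11 0)
  have hBle : ∀ {z : ℤ}, |z| ≤ q → bitLength z ≤ B := fun h =>
    bitLength_le_iff.2 ((h.trans (le_abs_self _)).trans_lt hqB)
  have hmod : ∀ z : ℤ, |z % q| ≤ q := fun z => by
    rw [abs_of_nonneg (Int.emod_nonneg z hq0.ne')]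
    exact (Int.emod_lt_of_pos z hq0).le
  have hcast : ∀ z : ℤ, ((z % q : ℤ) : ZMod q) = z := fun z => by
    rw [ZMod.intCast_eq_intCast_iff]
    exact Int.mod_modEq z q
  have hsize : (q - 2).size ≤ m := by
    refine le_trans ?_ hm
    rw [Nat.size_le]
    have : q < 2 ^ B := by rw [Nat.abs_cast] at hqB; exact_mod_cast hqB
    omega
  refine achieves_seq (R := fun s' => s' 20 0 = d % q ∧ ∀ x, x ≠ 20 → s' x = s x)
    (achieves_write hs ?_ ⟨?_, fun x hx => set_of_ne s hx _ _⟩) ?_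
  · simp only [Expr.eval, Op.apply, h17, h11]
    exact hBle (hmod d)
  · simp only [Expr.eval, Op.apply, h17, h11, set_var_self]
  rintro s1 hs1 ⟨h20, h1⟩
  have hev19 : (Expr.op .sub (.var 11) (.const 2)).eval s1 = ((q - 2 : ℕ) : ℤ) := by
    simp only [Expr.eval, Op.apply, h1 11 (by decide), h11]
    omega
  refine achieves_seq (R := fun s' => s' 19 0 = ((q - 2 : ℕ) : ℤ) ∧ ∀ x, x ≠ 19 → s' x = s1 x)
    (achieves_write hs1 ?_ ⟨?_, fun x hx => set_of_ne s1 hx _ _⟩) ?_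
  · rw [hev19]
    refine hBle ?_
    rw [Nat.abs_cast]
    omega
  · rw [hev19]
    exact set_var_self _ _ _
  rintro s2 hs2 ⟨h19, h2⟩
  refine achieves_seq (R := fun s' => s' 21 0 = 1 ∧ ∀ x, x ≠ 21 → s' x = s2 x)
    (achieves_write hs2 ?_ ⟨?_, fun x hx => set_of_ne s2 hx _ _⟩) ?_
  · refine hBle ?_
    simp only [Expr.eval, abs_one]
    omega
  · simp [Expr.eval, set_var_self]
  rintro s3 hs3 ⟨h21, h3⟩
  refine (achieves_loop hsize (fun k s' => s' 19 0 = (((q - 2) / 2 ^ k : ℕ) : ℤ) ∧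
    (s' 20 0 : ZMod q) ^ ((q - 2) / 2 ^ k) * (s' 21 0 : ZMod q) = (d : ZMod q) ^ (q - 2) ∧
    |s' 21 0| ≤ q ∧ ∀ x, x ∉ [19, 20, 21] → s' x = s x) hs3 ⟨?_, ?_, ?_, ?_⟩ ?_ ?_).mono ?_
  · rw [h3 19 (by decide), h19, pow_zero, Nat.div_one]
  · rw [h3 20 (by decide), h2 20 (by decide), h20, h21, hcast]
    simp
  · rw [h21, abs_one]
    omega
  · intro x hx
    rw [h3 x fun h => hx (by simp [h]), h2 x fun h => hx (by simp [h]),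
      h1 x fun h => hx (by simp [h])]
  · rintro k hk s4 hs4 ⟨k19, kpow, -, k1⟩
    have k11 : s4 11 0 = q := by rw [k1 11 (by decide), h11]
    have hpos : 0 < (q - 2) / 2 ^ k := Nat.div_pos (Nat.lt_size.1 hk) (by positivity)
    refine ⟨by simpa only [Expr.eval, k19] using mod_cast hpos, ?_⟩
    set a := (q - 2) / 2 ^ k with ha
    have ha2 : (q - 2) / 2 ^ (k + 1) = a / 2 := by rw [pow_succ, Nat.div_div_eq_div_mul]
    rw [ha2]
    refine achieves_seq (R := fun s' => s' 21 0 =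
      (s4 21 0 * (1 + ((a : ℤ) % 2) * (s4 20 0 - 1))) % q ∧ ∀ x, x ≠ 21 → s' x = s4 x)
      (achieves_write hs4 ?_ ⟨?_, fun x hx => set_of_ne s4 hx _ _⟩) ?_
    · simp only [Expr.eval, Op.apply, k11]
      exact hBle (hmod _)
    · simp only [Expr.eval, Op.apply, k11, k19, set_var_self]
    rintro s5 hs5 ⟨l21, l1⟩
    refine achieves_seq (R := fun s' => s' 20 0 = (s4 20 0 * s4 20 0) % q ∧
      ∀ x, x ≠ 20 → s' x = s5 x)
      (achieves_write hs5 ?_ ⟨?_, fun x hx => set_of_ne s5 hx _ _⟩) ?_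
    · simp only [Expr.eval, Op.apply, l1 11 (by decide), k11]
      exact hBle (hmod _)
    · simp only [Expr.eval, Op.apply, l1 11 (by decide), l1 20 (by decide), k11, set_var_self]
    rintro s6 hs6 ⟨m20, m1⟩
    have hev : (Expr.op .div (.var 19) (.const 2)).eval s6 = ((a / 2 : ℕ) : ℤ) := by
      simp only [Expr.eval, Op.apply, m1 19 (by decide), l1 19 (by decide), k19]
      rfl
    refine achieves_write hs6 ?_ ⟨?_, ?_, ?_, fun x hx => ?_⟩
    · rw [hev]
      refine hBle ?_
      rw [Nat.abs_cast]
      have h1 : a ≤ q - 2 := Nat.div_le_self _ _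
      have h2 : a / 2 ≤ a := Nat.div_le_self _ _
      omega
    · rw [hev]
      exact set_var_self _ _ _
    · rw [set_of_ne _ (by decide), set_of_ne _ (by decide), m20, m1 21 (by decide), l21, hcast,
        hcast, ← kpow]
      conv_rhs => rw [← Nat.div_add_mod a 2, pow_add, pow_mul]
      push_cast
      have hodd : (1 + ((a : ℤ) % 2 : ℤ) * ((s4 20 0 : ZMod q) - 1) : ZMod q) =
          (s4 20 0 : ZMod q) ^ (a % 2) := by
        rcases Nat.mod_two_eq_zero_or_one a with h | h
        · have : (a : ℤ) % 2 = 0 := by omega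
          simp [h, this]
        · have : (a : ℤ) % 2 = 1 := by omega
          simp [h, this]
      rw [hodd]
      ring
    · rw [set_of_ne _ (by decide), m1 21 (by decide), l21]
      exact hmod _
    · rw [set_of_ne _ fun h => hx (by simp [h]), m1 x fun h => hx (by simp [h]),
        l1 x fun h => hx (by simp [h]), k1 x hx]
  · rintro s4 - ⟨k19, -⟩
    have : (q - 2) / 2 ^ (q - 2).size = 0 := Nat.div_eq_of_lt (Nat.lt_size_self _)
    simp [Expr.eval, k19, this]
  · rintro s4 - ⟨-, kpow, k21, k1⟩
    refine ⟨k21, ?_, k1⟩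
    have : Fact q.Prime := ⟨hq⟩
    have hd0 : (d : ZMod q) ≠ 0 := by rwa [Ne, ZMod.intCast_zmod_eq_zero_iff_dvd]
    rw [Nat.div_eq_of_lt (Nat.lt_size_self _), pow_zero, one_mul] at kpow
    rw [← ZMod.intCast_zmod_eq_zero_iff_dvd]
    push_cast
    rw [kpow, ← pow_succ, show q - 2 + 1 = q - 1 by omega, ZMod.pow_card_sub_one_eq_one hd0,
      sub_self]

end BitCost

/-! ### The inversion program -/

namespace BitCost

/-- The sequences produced by the Faddeev–LeVerrier iteration for multiplication by the vector `t`,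
started at `t` and at `y`. Only the first `N` coordinates of the vectors matter. -/
structure IsFaddeevLeVerrier (N : ℕ) (tab t y : ℕ → ℤ) (c : ℕ → ℤ) (U Z : ℕ → ℕ → ℤ) : Prop where
  left_zero : ∀ i < N, U 0 i = t i
  right_zero : ∀ i < N, Z 0 i = y i
  coeff : ∀ k, k + 1 < N → c k = (0 - partialTrace N (U k) tab (N * N)) / ((k : ℤ) + 1)
  left_succ : ∀ k, k + 1 < N → ∀ i < N,
    U (k + 1) i = partialMul N t (U k) tab (N * N * N) i + c k * t i
  right_succ : ∀ k, k + 1 < N → ∀ i < N,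
    Z (k + 1) i = partialMul N t (Z k) tab (N * N * N) i + c k * y i

namespace IsFaddeevLeVerrier

variable {N : ℕ} {tab t y c : ℕ → ℤ} {U Z : ℕ → ℕ → ℤ} {M : ℤ}

theorem abs_coeff_le (h : IsFaddeevLeVerrier N tab t y c U Z) {k : ℕ} (hk : k + 1 < N)
    (hNM : ((N * N : ℕ) : ℤ) ≤ M) (htab : ∀ j < N * N * N, |tab j| ≤ M)
    (hU : ∀ j < N, |U k j| ≤ M ^ (4 * k + 1)) : |c k| ≤ M ^ (4 * k + 3) := by
  rw [h.coeff k hk]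
  refine (Int.abs_ediv_le_abs _ _).trans ?_
  rw [zero_sub, abs_neg]
  have hM : 0 ≤ M := (Int.natCast_nonneg _).trans hNM
  refine (abs_partialTrace_le (by omega) le_rfl hU htab).trans ?_
  calc ((N * N : ℕ) : ℤ) * (M ^ (4 * k + 1) * M) ≤ M * (M ^ (4 * k + 1) * M) := by gcongr
    _ = M ^ (4 * k + 3) := by ring

/-- One step of the iteration multiplies the size of the coordinates by at most `M ^ 4`; this holds
for the partial sums in the course of the computation as well. -/
theorem abs_step_le {w v : ℕ → ℤ} {a : ℤ} {k L i : ℕ} (hi : i < N) (hL : L ≤ N * N * N)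
    (hM : 2 ≤ M) (hNM : ((N * N * N : ℕ) : ℤ) ≤ M) (ht : ∀ j < N, |t j| ≤ M)
    (hw : ∀ j < N, |w j| ≤ M) (htab : ∀ j < N * N * N, |tab j| ≤ M)
    (hv : ∀ j < N, |v j| ≤ M ^ (4 * k + 1)) (ha : |a| ≤ M ^ (4 * k + 3)) :
    |partialMul N t v tab L i + a * w i| ≤ M ^ (4 * (k + 1) + 1) := by
  have hM0 : 0 ≤ M := by omega
  have hLM : (L : ℤ) ≤ M := le_trans (by exact_mod_cast hL) hNM
  have h1 := abs_partialMul_le (i := i) (by omega) hL ht hv htab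
  have h2 : |a * w i| ≤ M ^ (4 * k + 3) * M := by
    rw [abs_mul]
    exact mul_le_mul ha (hw i hi) (abs_nonneg _) (by positivity)
  have h3 : (L : ℤ) * (M * M ^ (4 * k + 1) * M) ≤ M * (M * M ^ (4 * k + 1) * M) := by gcongr
  calc |partialMul N t v tab L i + a * w i| ≤ M * (M * M ^ (4 * k + 1) * M) + M ^ (4 * k + 3) * M :=
        (abs_add_le _ _).trans (add_le_add (h1.trans h3) h2)
    _ = 2 * M ^ (4 * k + 4) := by ring
    _ ≤ M * M ^ (4 * k + 4) := by gcongr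
    _ = M ^ (4 * (k + 1) + 1) := by ring

theorem abs_le (h : IsFaddeevLeVerrier N tab t y c U Z) (hM : 2 ≤ M)
    (hNM : ((N * N * N : ℕ) : ℤ) ≤ M) (hNM' : ((N * N : ℕ) : ℤ) ≤ M)
    (ht : ∀ j < N, |t j| ≤ M) (hy : ∀ j < N, |y j| ≤ M)
    (htab : ∀ j < N * N * N, |tab j| ≤ M) {k : ℕ} (hk : k < N) :
    (∀ j < N, |U k j| ≤ M ^ (4 * k + 1)) ∧ ∀ j < N, |Z k j| ≤ M ^ (4 * k + 1) := by
  induction k with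
  | zero =>
    refine ⟨fun j hj => ?_, fun j hj => ?_⟩
    · simpa [h.left_zero j hj] using ht j hj
    · simpa [h.right_zero j hj] using hy j hj
  | succ k ih =>
    obtain ⟨hU, hZ⟩ := ih (by omega)
    have hc := h.abs_coeff_le hk hNM' htab hU
    refine ⟨fun j hj => ?_, fun j hj => ?_⟩
    · rw [h.left_succ k hk j hj]
      exact abs_step_le hj le_rfl hM hNM ht ht htab hU hc
    · rw [h.right_succ k hk j hj]
      exact abs_step_le hj le_rfl hM hNM ht hy htab hZ hc

end IsFaddeevLeVerrier

/-- One step of the Faddeev–LeVerrier iteration on the vectors in the arrays `6` and `7`. The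
number of the step is the variable `13`. -/
def iterationProg : Prog :=
  .seq traceProg
  (.seq (.assign 14 (.op .div (.op .sub (.const 0) (.var 16)) (.op .add (.var 13) (.const 1))))
  (.seq (mulAddProg 6 4) (mulAddProg 7 5)))

/-- Copy the dimension, the prime and the denominator of `y` to the variables `10`, `11`, `12`,
and the vectors `t` and `y` to the arrays `6` and `7`. -/
def initProg : Prog :=
  .seq (.assign 10 (.read 0 (.const 0)))
  (.seq (.assign 11 (.read 0 (.const 1)))
  (.seq (.assign 12 (.read 0 (.const 4)))
  (.seq (copyProg 4 6) (copyProg 5 7))))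

/-- Write the output: the numerators are the product of the variable `21` and the vector in array
`7`, the denominator is the product of the variables `18` and `12`. -/
def outputProg : Prog :=
  .seq (.for 15 (.var 10) (.write 0 (.op .add (.var 15) (.const 1))
      (.op .mul (.var 21) (.read 7 (.var 15)))))
    (.write 0 (.const 0) (.op .mul (.var 18) (.var 12)))

/-- The algorithm: compute `D` and the coordinates of `D t⁻¹ y` by the Faddeev–LeVerrier
iteration, split `D = q ^ e d` with `q ∤ d`, invert `d` modulo `q`, and output
`g (D t⁻¹ y) / q ^ e` with `g d ≡ 1` modulo `q`.

Besides the input arrays the program uses the arrays `6` and `7` for the two vectors of the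
iteration, the array `8` as a buffer, and the scalar variables `10` (dimension), `11` (`q`), `12`
(denominator of `y`), `13` (step of the iteration), `14` (coefficient), `15` (inner counter), `16`
(trace), `17` (`D`, later `d`), `18` (`q ^ e`) and `19`, `20`, `21` (powering, ending with `g`). -/
def inversionProg : Prog :=
  .seq initProg
  (.seq (.for 13 (.op .sub (.var 10) (.const 1)) iterationProg)
  (.seq traceProg
  (.seq (.assign 17 (.op .div (.var 16) (.var 10)))
  (.seq stripProg
  (.seq invProg outputProg)))))

variable {m B N : ℕ} {s : Store}

theorem achieves_initProg (hs : Bounded B s) (hN : s 0 0 = N) (hm : N ≤ m)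
    (hB : bitLength N ≤ B) :
    Achieves m B initProg s fun s' => s' 10 0 = N ∧ s' 11 0 = s 0 1 ∧ s' 12 0 = s 0 4 ∧
      (∀ i < N, s' 6 (i : ℕ) = s 4 (i : ℕ)) ∧ (∀ i < N, s' 7 (i : ℕ) = s 5 (i : ℕ)) ∧
      ∀ x, x ∉ [6, 7, 10, 11, 12, 15] → s' x = s x := by
  refine achieves_seq (R := fun s' => s' 10 0 = N ∧ ∀ x, x ≠ 10 → s' x = s x)
    (achieves_write hs (hs _ _) ⟨?_, fun x hx => set_of_ne s hx _ _⟩) ?_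
  · simp only [Expr.eval, set_var_self, hN]
  rintro s1 hs1 ⟨h10, h1⟩
  refine achieves_seq (R := fun s' => s' 11 0 = s 0 1 ∧ ∀ x, x ≠ 11 → s' x = s1 x)
    (achieves_write hs1 (hs1 _ _) ⟨?_, fun x hx => set_of_ne s1 hx _ _⟩) ?_
  · simp only [Expr.eval, set_var_self, h1 0 (by decide)]
  rintro s2 hs2 ⟨h11, h2⟩
  refine achieves_seq (R := fun s' => s' 12 0 = s 0 4 ∧ ∀ x, x ≠ 12 → s' x = s2 x)
    (achieves_write hs2 (hs2 _ _) ⟨?_, fun x hx => set_of_ne s2 hx _ _⟩) ?_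
  · simp only [Expr.eval, set_var_self, h2 0 (by decide), h1 0 (by decide)]
  rintro s3 hs3 ⟨h12, h3⟩
  refine achieves_seq (achieves_copyProg (N := N) hs3
    (by rw [h3 10 (by decide), h2 10 (by decide), h10]) hm hB (by decide) (by decide)
    (by decide) (by decide)) ?_
  rintro s4 hs4 ⟨h6, h4⟩
  refine (achieves_copyProg (N := N) hs4 (by rw [h4 10 (by decide) (by decide), h3 10 (by decide),
    h2 10 (by decide), h10]) hm hB (by decide) (by decide) (by decide) (by decide)).mono ?_
  rintro s5 - ⟨h7, h5⟩
  refine ⟨?_, ?_, ?_, fun i hi => ?_, fun i hi => ?_, fun x hx => ?_⟩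
  · rw [h5 10 (by decide) (by decide), h4 10 (by decide) (by decide), h3 10 (by decide),
      h2 10 (by decide), h10]
  · rw [h5 11 (by decide) (by decide), h4 11 (by decide) (by decide), h3 11 (by decide), h11]
  · rw [h5 12 (by decide) (by decide), h4 12 (by decide) (by decide), h12]
  · rw [h5 6 (by decide) (by decide), h6 i hi, h3 4 (by decide), h2 4 (by decide),
      h1 4 (by decide)]
  · rw [h7 i hi, h4 5 (by decide) (by decide), h3 5 (by decide), h2 5 (by decide),
      h1 5 (by decide)]
  · rw [h5 x (fun h => hx (by simp [h])) fun h => hx (by simp [h]),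
      h4 x (fun h => hx (by simp [h])) fun h => hx (by simp [h]),
      h3 x fun h => hx (by simp [h]), h2 x fun h => hx (by simp [h]),
      h1 x fun h => hx (by simp [h])]

theorem achieves_outputProg (hs : Bounded B s) (hN : s 10 0 = N) (hm : N ≤ m)
    (hB : bitLength N ≤ B) (hnum : ∀ i < N, bitLength (s 21 0 * s 7 (i : ℕ)) ≤ B)
    (hden : bitLength (s 18 0 * s 12 0) ≤ B) :
    Achieves m B outputProg s fun s' => s' 0 0 = s 18 0 * s 12 0 ∧
      ∀ i < N, s' 0 ((i : ℕ) + 1) = s 21 0 * s 7 (i : ℕ) := by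
  refine achieves_seq (achieves_for_write hm hB (by decide)
    (fun k j => overwrite (fun i => s 21 0 * s 7 i) (fun j => s 0 (j + 1)) k (j - 1)) hs ?_ ?_ ?_) ?_
  · simp only [overwrite_zero, sub_add_cancel]
  · intro s' h
    simp only [Expr.eval, h 10 (by decide) (by decide), hN]
  · intro k hk s' hc _ h
    simp only [Expr.eval, Op.apply, hc, h 21 (by decide) (by decide), h 7 (by decide) (by decide)]
    refine ⟨?_, hnum k hk⟩
    funext j
    rw [overwrite_succ]
    simp only [Function.update_apply]
    refine if_congr ?_ rfl rfl
    omega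
  · rintro s1 hs1 ⟨h0, h1⟩
    have hev : (Expr.op .mul (.var 18) (.var 12)).eval s1 = s 18 0 * s 12 0 := by
      simp only [Expr.eval, Op.apply, h1 18 (by decide) (by decide), h1 12 (by decide) (by decide)]
    refine achieves_write hs1 (hev ▸ hden) ⟨?_, fun i hi => ?_⟩
    · rw [hev]
      exact set_var_self _ _ _
    · have hne : ((i : ℕ) : ℤ) + 1 ≠ (Expr.const 0).eval s1 := by
        simp only [Expr.eval]
        omega
      rw [set_same, Function.update_of_ne hne, h0]
      simp only [add_sub_cancel_right, overwrite_apply hi]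

/-- The relations between the parameters under which the computation stays within its resources:
`M` bounds the entries of the input, words of `B` digits leave room for `M ^ (4 * N + 2)`, and `m`
iterations suffice for a loop over all structure constants. -/
structure Resources (m B N : ℕ) (M : ℤ) (tab t y : ℕ → ℤ) : Prop where
  pos : 0 < N
  two_le : 2 ≤ M
  cube_le : ((N * N * N : ℕ) : ℤ) ≤ M
  le_steps : N * N * N ≤ m
  pow_lt : M ^ (4 * N + 2) < 2 ^ B
  left : ∀ j < N, |t j| ≤ M
  right : ∀ j < N, |y j| ≤ M
  table : ∀ j < N * N * N, |tab j| ≤ M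

namespace Resources

variable {M : ℤ} {tab t y c : ℕ → ℤ} {U Z : ℕ → ℕ → ℤ}

theorem bitLength_le (h : Resources m B N M tab t y) {z : ℤ} {j : ℕ} (hz : |z| ≤ M ^ j)
    (hj : j ≤ 4 * N + 2) : bitLength z ≤ B :=
  bitLength_le_iff.2 (hz.trans_lt
    ((pow_le_pow_right₀ (by linarith [h.two_le]) hj).trans_lt h.pow_lt))

theorem square_le (h : Resources m B N M tab t y) : ((N * N : ℕ) : ℤ) ≤ M :=
  le_trans (by exact_mod_cast Nat.le_mul_of_pos_right _ h.pos) h.cube_le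

theorem abs_trace_le (h : Resources m B N M tab t y) {v : ℕ → ℤ} {k L : ℕ}
    (hL : L ≤ N * N) (hv : ∀ j < N, |v j| ≤ M ^ (4 * k + 1)) :
    |partialTrace N v tab L| ≤ M ^ (4 * k + 3) := by
  have hM : 0 ≤ M := by linarith [h.two_le]
  have hLM : (L : ℤ) ≤ M := le_trans (by exact_mod_cast hL) h.square_le
  refine (abs_partialTrace_le h.pos hL hv h.table).trans ?_
  calc (L : ℤ) * (M ^ (4 * k + 1) * M) ≤ M * (M ^ (4 * k + 1) * M) := by gcongr
    _ = M ^ (4 * k + 3) := by ring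

theorem bitLength_dim (h : Resources m B N M tab t y) : bitLength N ≤ B := by
  refine h.bitLength_le (j := 1) ?_ (by omega)
  rw [Nat.abs_cast, pow_one]
  refine le_trans ?_ h.square_le
  exact_mod_cast Nat.le_mul_of_pos_right _ h.pos

theorem bitLength_square (h : Resources m B N M tab t y) : bitLength (N * N : ℕ) ≤ B :=
  h.bitLength_le (j := 1) (by rw [Nat.abs_cast, pow_one]; exact h.square_le) (by omega)

theorem bitLength_cube (h : Resources m B N M tab t y) : bitLength (N * N * N : ℕ) ≤ B :=
  h.bitLength_le (j := 1) (by rw [Nat.abs_cast, pow_one]; exact h.cube_le) (by omega)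

theorem square_le_steps (h : Resources m B N M tab t y) : N * N ≤ m :=
  (Nat.le_mul_of_pos_right _ h.pos).trans h.le_steps

theorem dim_le_steps (h : Resources m B N M tab t y) : N ≤ m :=
  (Nat.le_mul_of_pos_right _ h.pos).trans h.square_le_steps

theorem achieves_trace (h : Resources m B N M tab t y) {v : ℕ → ℤ} {k : ℕ} (hk : k < N)
    (hv : ∀ j < N, |v j| ≤ M ^ (4 * k + 1)) (hs : Bounded B s) (hN : s 10 0 = N)
    (htab : (fun i : ℕ => s 1 i) = tab) (hsv : ∀ i < N, s 6 (i : ℕ) = v i) :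
    Achieves m B traceProg s fun s' => s' 16 0 = partialTrace N v tab (N * N) ∧
      ∀ x, x ≠ 16 → x ≠ 15 → s' x = s x := by
  refine (achieves_traceProg hs hN h.square_le_steps h.bitLength_square fun L hL => ?_).mono ?_
  · rw [htab, partialTrace_congr hsv hL]
    exact h.bitLength_le (h.abs_trace_le hL hv) (by omega)
  · rintro s' - ⟨h1, h2⟩
    rw [htab, partialTrace_congr hsv le_rfl] at h1
    exact ⟨h1, h2⟩

theorem achieves_mulAdd (h : Resources m B N M tab t y) {dst orig : ℕ} {v w : ℕ → ℤ} {a : ℤ}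
    {k : ℕ} (hk : k + 1 < N) (hv : ∀ j < N, |v j| ≤ M ^ (4 * k + 1))
    (hw : ∀ j < N, |w j| ≤ M) (ha : |a| ≤ M ^ (4 * k + 3)) (hs : Bounded B s) (hN : s 10 0 = N)
    (htab : (fun i : ℕ => s 1 i) = tab) (ht : (fun i : ℕ => s 4 i) = t) (hsa : s 14 0 = a)
    (hsv : ∀ i < N, s dst (i : ℕ) = v i) (hsw : (fun i : ℕ => s orig i) = w)
    (hd8 : dst ≠ 8) (hd10 : dst ≠ 10) (hd15 : dst ≠ 15) (ho8 : orig ≠ 8) (ho15 : orig ≠ 15) :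
    Achieves m B (mulAddProg dst orig) s fun s' =>
      (∀ i < N, s' dst (i : ℕ) = partialMul N t v tab (N * N * N) i + a * w i) ∧
      ∀ x, x ≠ 8 → x ≠ dst → x ≠ 15 → s' x = s x := by
  have hsw' : ∀ i : ℕ, s orig (i : ℤ) = w i := fun i => congrFun hsw i
  refine (achieves_mulAddProg hs hN h.pos h.le_steps h.bitLength_cube hd8 hd10 hd15 ho8 ho15
    fun i hi L hL => ?_).mono ?_
  · rw [htab, ht, partialMul_congr hsv h.pos, hsa, hsw', add_comm]
    exact h.bitLength_le (IsFaddeevLeVerrier.abs_step_le hi hL h.two_le h.cube_le h.left hw h.table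
      hv ha) (by omega)
  · rintro s' - ⟨h1, h2⟩
    refine ⟨fun i hi => ?_, h2⟩
    rw [h1 i hi, htab, ht, partialMul_congr hsv h.pos, hsa, hsw']

theorem achieves_iteration (h : Resources m B N M tab t y)
    (hF : IsFaddeevLeVerrier N tab t y c U Z) {k : ℕ} (hk : k + 1 < N) (hs : Bounded B s)
    (hN : s 10 0 = N) (htab : (fun i : ℕ => s 1 i) = tab) (ht : (fun i : ℕ => s 4 i) = t)
    (hy : (fun i : ℕ => s 5 i) = y) (h13 : s 13 0 = k) (h6 : ∀ i < N, s 6 (i : ℕ) = U k i)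
    (h7 : ∀ i < N, s 7 (i : ℕ) = Z k i) :
    Achieves m B iterationProg s fun s' => (∀ i < N, s' 6 (i : ℕ) = U (k + 1) i) ∧
      (∀ i < N, s' 7 (i : ℕ) = Z (k + 1) i) ∧ ∀ x, x ∉ [6, 7, 8, 14, 15, 16] → s' x = s x := by
  obtain ⟨hU, hZ⟩ := hF.abs_le h.two_le h.cube_le h.square_le h.left h.right h.table
    (k := k) (by omega)
  have hc := hF.abs_coeff_le hk h.square_le h.table hU
  refine achieves_seq (h.achieves_trace (by omega) hU hs hN htab h6) ?_
  rintro s1 hs1 ⟨h16, h1⟩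
  have hev : (Expr.op .div (.op .sub (.const 0) (.var 16)) (.op .add (.var 13) (.const 1))).eval s1
      = c k := by
    simp only [Expr.eval, Op.apply, h16, h1 13 (by decide) (by decide), h13, hF.coeff k hk]
  refine achieves_seq (R := fun s' => s' 14 0 = c k ∧ ∀ x, x ≠ 14 → s' x = s1 x)
    (achieves_write hs1 ?_ ⟨?_, fun x hx => set_of_ne s1 hx _ _⟩) ?_
  · rw [hev]
    exact h.bitLength_le hc (by omega)
  · rw [hev]
    exact set_var_self _ _ _
  rintro s2 hs2 ⟨h14, h2⟩
  have e2 : ∀ x, x ∉ [6, 7, 8, 14, 15, 16] → s2 x = s x := fun x hx => by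
    rw [h2 x fun h => hx (by simp [h]), h1 x (fun h => hx (by simp [h])) fun h => hx (by simp [h])]
  refine achieves_seq (h.achieves_mulAdd hk hU h.left hc hs2 (by rw [e2 10 (by decide), hN])
    (by rw [e2 1 (by decide), htab]) (by rw [e2 4 (by decide), ht]) h14 (fun i hi => by
      rw [h2 6 (by decide), h1 6 (by decide) (by decide), h6 i hi])
    (by rw [e2 4 (by decide), ht]) (by decide) (by decide) (by decide) (by decide) (by decide)) ?_
  rintro s3 hs3 ⟨h36, h3⟩
  have e3 : ∀ x, x ∉ [6, 7, 8, 14, 15, 16] → s3 x = s x := fun x hx => by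
    rw [h3 x (fun h => hx (by simp [h])) (fun h => hx (by simp [h])) fun h => hx (by simp [h]),
      e2 x hx]
  refine (h.achieves_mulAdd hk hZ h.right hc hs3 (by rw [e3 10 (by decide), hN])
    (by rw [e3 1 (by decide), htab]) (by rw [e3 4 (by decide), ht])
    (by rw [h3 14 (by decide) (by decide) (by decide), h14]) (fun i hi => by
      rw [h3 7 (by decide) (by decide) (by decide), h2 7 (by decide),
        h1 7 (by decide) (by decide), h7 i hi])
    (by rw [e3 5 (by decide), hy]) (by decide) (by decide) (by decide) (by decide)
    (by decide)).mono ?_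
  rintro s4 - ⟨h47, h4⟩
  refine ⟨fun i hi => ?_, fun i hi => ?_, fun x hx => ?_⟩
  · rw [h4 6 (by decide) (by decide) (by decide), h36 i hi, hF.left_succ k hk i hi]
  · rw [h47 i hi, hF.right_succ k hk i hi]
  · rw [h4 x (fun h => hx (by simp [h])) (fun h => hx (by simp [h])) fun h => hx (by simp [h]),
      e3 x hx]

theorem achieves_inversionProg {q : ℕ} (h : Resources m B N M tab t y)
    (hF : IsFaddeevLeVerrier N tab t y c U Z) (hs : Bounded B s) (hBm : B ≤ m)
    (hN : s 0 0 = N) (htab : (fun i : ℕ => s 1 i) = tab) (ht : (fun i : ℕ => s 4 i) = t)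
    (hy : (fun i : ℕ => s 5 i) = y) (hq : q.Prime) (hsq : s 0 1 = q) (hqM : (q : ℤ) ≤ M)
    (hden : |s 0 4| ≤ M) (hD : partialTrace N (U (N - 1)) tab (N * N) / N ≠ 0) :
    Achieves m B inversionProg s fun s' => ∃ (e : ℕ) (d g : ℤ),
      partialTrace N (U (N - 1)) tab (N * N) / N = q ^ e * d ∧ ¬ (q : ℤ) ∣ d ∧
      (q : ℤ) ∣ g * d - 1 ∧ s' 0 0 = q ^ e * s 0 4 ∧
      ∀ i < N, s' 0 ((i : ℕ) + 1) = g * Z (N - 1) i := by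
  have hpos := h.pos
  have hM0 : 0 ≤ M := by linarith [h.two_le]
  obtain ⟨hU, hZ⟩ := hF.abs_le h.two_le h.cube_le h.square_le h.left h.right h.table
    (k := N - 1) (by omega)
  refine achieves_seq (achieves_initProg hs hN h.dim_le_steps h.bitLength_dim) ?_
  rintro s1 hs1 ⟨h10, h11, h12, h6, h7, h1⟩
  refine achieves_seq (achieves_for (n := N - 1) ((Nat.sub_le _ _).trans h.dim_le_steps) ?_
    (fun k s' => (∀ i < N, s' 6 (i : ℕ) = U k i) ∧ (∀ i < N, s' 7 (i : ℕ) = Z k i) ∧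
      ∀ x, x ∉ [6, 7, 8, 13, 14, 15, 16] → s' x = s1 x) hs1 ?_ ?_ ⟨?_, ?_, fun _ _ => rfl⟩ ?_) ?_
  · refine (bitLength_mono ?_).trans h.bitLength_dim
    simp only [Nat.abs_cast]
    omega
  · rintro k s' z ⟨k6, k7, k1⟩
    refine ⟨fun i hi => ?_, fun i hi => ?_, fun x hx => ?_⟩
    · rw [set_of_ne _ (by decide), k6 i hi]
    · rw [set_of_ne _ (by decide), k7 i hi]
    · rw [set_of_ne _ fun h => hx (by simp [h]), k1 x hx]
  · rintro k s' ⟨-, -, k1⟩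
    simp only [Expr.eval, Op.apply, k1 10 (by decide), h10]
    omega
  · intro i hi
    rw [h6 i hi, hF.left_zero i hi, ← ht]
  · intro i hi
    rw [h7 i hi, hF.right_zero i hi, ← hy]
  · rintro k hk s2 hs2 h13 ⟨k6, k7, k1⟩
    refine (h.achieves_iteration hF (by omega) hs2 (by rw [k1 10 (by decide), h10])
      (by rw [k1 1 (by decide), h1 1 (by decide), htab])
      (by rw [k1 4 (by decide), h1 4 (by decide), ht])
      (by rw [k1 5 (by decide), h1 5 (by decide), hy]) h13 k6 k7).mono ?_
    rintro s3 - ⟨l6, l7, l1⟩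
    refine ⟨by rw [l1 13 (by decide), h13], l6, l7, fun x hx => ?_⟩
    rw [l1 x fun h => hx (by simp at h ⊢; tauto), k1 x hx]
  rintro s2 hs2 ⟨k6, k7, k1⟩
  refine achieves_seq (h.achieves_trace (k := N - 1) (by omega) hU hs2
    (by rw [k1 10 (by decide), h10]) (by rw [k1 1 (by decide), h1 1 (by decide), htab]) k6) ?_
  rintro s3 hs3 ⟨h16, h3⟩
  have hDle : |partialTrace N (U (N - 1)) tab (N * N) / N| ≤ M ^ (4 * (N - 1) + 3) :=
    (Int.abs_ediv_le_abs _ _).trans (h.abs_trace_le le_rfl hU)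
  have hev : (Expr.op .div (.var 16) (.var 10)).eval s3 =
      partialTrace N (U (N - 1)) tab (N * N) / N := by
    simp only [Expr.eval, Op.apply, h16, h3 10 (by decide) (by decide), k1 10 (by decide), h10]
  refine achieves_seq (R := fun s' => s' 17 0 = partialTrace N (U (N - 1)) tab (N * N) / N ∧
    ∀ x, x ≠ 17 → s' x = s3 x) (achieves_write hs3 ?_ ⟨?_, fun x hx => set_of_ne s3 hx _ _⟩) ?_
  · rw [hev]
    exact h.bitLength_le hDle (by omega)
  · rw [hev]
    exact set_var_self _ _ _
  rintro s4 hs4 ⟨h17, h4⟩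
  have e4 : ∀ x, x ∉ [6, 7, 8, 13, 14, 15, 16, 17] → s4 x = s1 x := fun x hx => by
    rw [h4 x fun h => hx (by simp [h]), h3 x (fun h => hx (by simp [h])) fun h => hx (by simp [h]),
      k1 x fun h => hx (by simp at h ⊢; tauto)]
  refine achieves_seq (achieves_stripProg hs4 hBm hq.two_le hD h17
    (by rw [e4 11 (by decide), h11, hsq])) ?_
  rintro s5 hs5 ⟨e, d, hd, hqd, h17', h18, h5⟩
  refine achieves_seq (achieves_invProg hs5 hBm hq hqd h17'
    (by rw [h5 11 (by decide), e4 11 (by decide), h11, hsq])) ?_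
  rintro s6 hs6 ⟨h21, hg, h6'⟩
  have e6 : ∀ x, x ∉ [6, 7, 8, 13, 14, 15, 16, 17, 18, 19, 20, 21] → s6 x = s1 x := fun x hx => by
    rw [h6' x fun h => hx (by simp at h ⊢; tauto), h5 x fun h => hx (by simp at h ⊢; tauto),
      e4 x fun h => hx (by simp at h ⊢; tauto)]
  have h67 : ∀ i < N, s6 7 (i : ℕ) = Z (N - 1) i := fun i hi => by
    rw [h6' 7 (by decide), h5 7 (by decide), h4 7 (by decide), h3 7 (by decide) (by decide),
      k7 i hi]
  have h618 : s6 18 0 = q ^ e := by rw [h6' 18 (by decide), h18]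
  have h612 : s6 12 0 = s 0 4 := by rw [e6 12 (by decide), h12]
  have hd1 : 1 ≤ |d| := Int.one_le_abs (by rintro rfl; simp at hqd)
  have hqe : |(q : ℤ) ^ e| ≤ M ^ (4 * (N - 1) + 3) := by
    refine le_trans ?_ hDle
    rw [hd, abs_mul]
    exact le_mul_of_one_le_right (abs_nonneg _) hd1
  refine (achieves_outputProg hs6 (by rw [e6 10 (by decide), h10]) h.dim_le_steps h.bitLength_dim
    (fun i hi => ?_) ?_).mono ?_
  · refine h.bitLength_le (j := 4 * (N - 1) + 2) ?_ (by omega)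
    rw [h67 i hi, abs_mul, pow_succ' M (4 * (N - 1) + 1)]
    exact mul_le_mul (h21.trans hqM) (hZ i hi) (abs_nonneg _) hM0
  · refine h.bitLength_le (j := 4 * (N - 1) + 4) ?_ (by omega)
    rw [h618, h612, abs_mul, pow_succ M (4 * (N - 1) + 3)]
    exact mul_le_mul hqe hden (abs_nonneg _) (by positivity)
  · rintro s7 - ⟨h70, h71⟩
    refine ⟨e, d, s6 21 0, hd, hqd, hg, by rw [h70, h618, h612], fun i hi => ?_⟩
    rw [h71 i hi, h67 i hi]

end Resources

end BitCost

/-! ### The adjugate of the characteristic matrix -/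

section FaddeevLeVerrier

open Polynomial Matrix

/-- Jacobi's formula for matrices of polynomials. -/
theorem Matrix.derivative_det {n R : Type*} [Fintype n] [DecidableEq n] [CommRing R]
    (M : Matrix n n R[X]) :
    derivative M.det = (M.adjugate * M.map derivative).trace := by
  have h : ∀ i, (M.adjugate * M.map derivative) i i =
      (M.updateCol i fun j => derivative (M j i)).det := by
    intro i
    rw [← cramer_apply, cramer_eq_adjugate_mulVec]
    rfl
  simp only [trace, diag_apply, h, det_apply', derivative_sum]
  rw [Finset.sum_comm]
  refine Finset.sum_congr rfl fun σ _ => ?_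
  rw [← Polynomial.C_eq_intCast, derivative_C_mul, derivative_prod_finset, Finset.mul_sum]
  refine Finset.sum_congr rfl fun i _ => ?_
  rw [← Finset.prod_erase_mul _ _ (Finset.mem_univ i)]
  congr 2
  · refine Finset.prod_congr rfl fun j hj => ?_
    rw [updateCol_ne (Finset.ne_of_mem_erase hj)]
  · rw [updateCol_self]

variable {n R : Type*} [Fintype n] [DecidableEq n] [CommRing R] (T : Matrix n n R)

/-- The coefficient of `X ^ k` in the adjugate of `X - T`, a matrix over `R`. -/
noncomputable def Matrix.adjugateCoeff (k : ℕ) : Matrix n n R :=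
  (charmatrix T).adjugate.map fun p => p.coeff k

namespace Matrix

theorem charmatrix_mul_adjugate_coeff (i j : n) (k : ℕ) :
    ((charmatrix T * (charmatrix T).adjugate) i j).coeff k =
      (X * (charmatrix T).adjugate i j).coeff k - (T * T.adjugateCoeff k) i j := by
  have h : charmatrix T * (charmatrix T).adjugate =
      (X : R[X]) • (charmatrix T).adjugate - T.map C * (charmatrix T).adjugate := by
    rw [charmatrix, sub_mul]
    simp [smul_eq_diagonal_mul]
  rw [h, sub_apply, coeff_sub, smul_apply, smul_eq_mul]
  simp [mul_apply, adjugateCoeff]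

theorem charpoly_smul_one_coeff (i j : n) (k : ℕ) :
    ((charmatrix T * (charmatrix T).adjugate) i j).coeff k =
      (T.charpoly.coeff k • (1 : Matrix n n R)) i j := by
  rw [mul_adjugate, smul_apply, smul_apply, one_apply, one_apply]
  split_ifs <;> simp [charpoly]

/-- Horner's recursion for the coefficients of the adjugate of `X - T`. -/
theorem adjugateCoeff_eq (k : ℕ) :
    T.adjugateCoeff k = T * T.adjugateCoeff (k + 1) + T.charpoly.coeff (k + 1) • 1 := by
  ext i j
  have h := T.charmatrix_mul_adjugate_coeff i j (k + 1)
  rw [charpoly_smul_one_coeff, coeff_X_mul] at h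
  rw [add_apply, h]
  simp [adjugateCoeff]

theorem mul_adjugateCoeff_zero :
    T * T.adjugateCoeff 0 = -T.charpoly.coeff 0 • 1 := by
  ext i j
  have h := T.charmatrix_mul_adjugate_coeff i j 0
  rw [charpoly_smul_one_coeff, coeff_X_mul_zero, zero_sub] at h
  rw [neg_smul, neg_apply, h, neg_neg]

theorem adjugateCoeff_eq_zero {k : ℕ} (hk : Fintype.card n ≤ k) : T.adjugateCoeff k = 0 := by
  nontriviality R
  have hstep : ∀ l, T.adjugateCoeff k = T ^ l * T.adjugateCoeff (k + l) := by
    intro l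
    induction l with
    | zero => simp
    | succ l ih =>
      have : T.charpoly.coeff (k + l + 1) = 0 := by
        refine coeff_eq_zero_of_natDegree_lt ?_
        rw [charpoly_natDegree_eq_dim]
        omega
      rw [ih, adjugateCoeff_eq, this, zero_smul, add_zero, pow_succ, mul_assoc, add_assoc]
  rw [hstep (∑ i, ∑ j, ((charmatrix T).adjugate i j).natDegree + 1)]
  suffices h : T.adjugateCoeff (k + (∑ i, ∑ j, ((charmatrix T).adjugate i j).natDegree + 1)) = 0 by
    rw [h, mul_zero]
  ext i j
  refine coeff_eq_zero_of_natDegree_lt ?_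
  have h1 := Finset.single_le_sum (f := fun j => ((charmatrix T).adjugate i j).natDegree)
    (fun _ _ => Nat.zero_le _) (Finset.mem_univ j)
  have h2 := Finset.single_le_sum (f := fun i => ∑ j, ((charmatrix T).adjugate i j).natDegree)
    (fun _ _ => Nat.zero_le _) (Finset.mem_univ i)
  change ((charmatrix T).adjugate i j).natDegree < _
  omega

/-- The coefficients of the derivative of the characteristic polynomial are the traces of the
coefficients of the adjugate of `X - T`. -/
theorem trace_adjugateCoeff (k : ℕ) :
    (T.adjugateCoeff k).trace = (k + 1) * T.charpoly.coeff (k + 1) := by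
  have hd : (charmatrix T).map derivative = 1 := by
    ext1 i j
    by_cases h : i = j
    · subst h
      simp
    · simp [h]
  have h := derivative_det (charmatrix T)
  rw [hd, mul_one] at h
  have h' := congrArg (fun p => p.coeff k) h
  simp only [coeff_derivative] at h'
  rw [mul_comm]
  refine Eq.trans ?_ h'.symm
  simp [trace, adjugateCoeff]

end Matrix

section Algebra

variable {R S : Type*} [CommRing R] [Ring S] [Algebra R S] {N : ℕ}
  (b : Module.Basis (Fin N) R S) (τ : S)

/-- The elements `1, τ + c₁, τ² + c₁ τ + c₂, …`, where `X ^ N + c₁ X ^ (N - 1) + ⋯ + c_N` is the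
characteristic polynomial of multiplication by `τ`. Only the terms with index less than `N` are
meaningful, because the index `N - 1 - k` of the coefficient is truncated at `0`. -/
noncomputable def hornerSeq : ℕ → S
  | 0 => 1
  | k + 1 => τ * hornerSeq k + (Algebra.leftMulMatrix b τ).charpoly.coeff (N - 1 - k) • (1 : S)

theorem leftMulMatrix_hornerSeq {k : ℕ} (hk : k < N) :
    Algebra.leftMulMatrix b (hornerSeq b τ k) =
      (Algebra.leftMulMatrix b τ).adjugateCoeff (N - 1 - k) := by
  nontriviality R
  induction k with
  | zero =>
    have hc : (Algebra.leftMulMatrix b τ).charpoly.coeff N = 1 := by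
      have := (Algebra.leftMulMatrix b τ).charpoly_monic.coeff_natDegree
      rwa [charpoly_natDegree_eq_dim, Fintype.card_fin] at this
    rw [hornerSeq, adjugateCoeff_eq, show N - 1 - 0 + 1 = N by omega,
      adjugateCoeff_eq_zero _ (by simp), hc]
    simp
  | succ k ih =>
    rw [hornerSeq, adjugateCoeff_eq, show N - 1 - (k + 1) + 1 = N - 1 - k by omega, map_add,
      map_mul, ih (by omega), map_smul, map_one]

/-- The characteristic polynomial is determined by the traces of the elements `hornerSeq`. -/
theorem trace_leftMulMatrix_mul_hornerSeq {k : ℕ} (hk : k < N) :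
    (Algebra.leftMulMatrix b (τ * hornerSeq b τ k)).trace =
      -((k + 1) * (Algebra.leftMulMatrix b τ).charpoly.coeff (N - 1 - k)) := by
  rw [map_mul, leftMulMatrix_hornerSeq b τ hk]
  rcases Nat.lt_or_ge (k + 1) N with h | h
  · obtain ⟨l, rfl⟩ : ∃ l, N = l + k + 2 := ⟨N - (k + 2), by omega⟩
    have h1 := (Algebra.leftMulMatrix b τ).adjugateCoeff_eq l
    have h2 := (Algebra.leftMulMatrix b τ).trace_adjugateCoeff l
    rw [h1, trace_add, trace_smul, trace_one, Fintype.card_fin, smul_eq_mul] at h2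
    rw [show l + k + 2 - 1 - k = l + 1 by omega, eq_sub_of_add_eq h2]
    push_cast
    ring
  · obtain rfl : N = k + 1 := by omega
    rw [show k + 1 - 1 - k = 0 by omega, mul_adjugateCoeff_zero, trace_smul, trace_one,
      Fintype.card_fin, smul_eq_mul]
    push_cast
    ring

theorem mul_hornerSeq_last (hN : 0 < N) :
    τ * hornerSeq b τ (N - 1) = -(Algebra.leftMulMatrix b τ).charpoly.coeff 0 • (1 : S) := by
  refine Algebra.leftMulMatrix_injective b ?_
  rw [map_mul, leftMulMatrix_hornerSeq b τ (by omega), Nat.sub_self, mul_adjugateCoeff_zero,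
    map_smul, map_one]

theorem charpoly_leftMulMatrix_coeff_zero_ne_zero [IsDomain R]
    (hτ : ∀ x, τ * x = 0 → x = 0) :
    (Algebra.leftMulMatrix b τ).charpoly.coeff 0 ≠ 0 := by
  intro h
  have hdet : (Algebra.leftMulMatrix b τ).det = 0 := by
    rw [det_eq_sign_charpoly_coeff, h, mul_zero]
  obtain ⟨v, hv, hv'⟩ := exists_mulVec_eq_zero_iff.2 hdet
  have h1 := Algebra.leftMulMatrix_mulVec_repr b τ (b.equivFun.symm v)
  have h2 : (b.repr (b.equivFun.symm v) : Fin N → R) = v := b.equivFun.apply_symm_apply v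
  rw [h2, hv'] at h1
  have h3 : τ * b.equivFun.symm v = 0 := b.equivFun.injective (by
    rw [map_zero]
    exact h1.symm)
  exact hv ((LinearEquiv.map_eq_zero_iff _).1 (hτ _ h3))

end Algebra

end FaddeevLeVerrier

/-! ### Two-sided ideals of a maximal order -/

section MaximalOrder

variable {K A : Type*} [Field K] [Ring A] [Algebra K A] {Λ : Subring A}

/-- An overring of a `ℤ`-order that is moved into the order by a unit is a `ℤ`-order. -/
theorem IsMaximalZOrder.eq_of_mul_mem (hΛ : IsMaximalZOrder Λ) {Γ : Subring A} (hle : Λ ≤ Γ)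
    {t t' : A} (ht : t' * t = 1) (h : ∀ a ∈ Γ, t * a ∈ Λ) : Γ = Λ := by
  refine hΛ.2 Γ ⟨?_, fun a => ?_⟩ hle
  · have hfg : Module.Finite ℤ Λ.toAddSubgroup :=
      Module.Finite.iff_addGroup_fg.2 ((AddGroup.fg_iff_addSubgroup_fg _).2 hΛ.1.1)
    let f : Γ.toAddSubgroup →+ Λ.toAddSubgroup :=
      { toFun := fun a => ⟨t * a, h a a.2⟩
        map_zero' := by ext; simp
        map_add' := fun a b => by ext; simp [mul_add] }
    have hf : Function.Injective f.toIntLinearMap := by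
      intro a b hab
      have h1 : t * (a : A) = t * b := congrArg Subtype.val hab
      have h2 := congrArg (t' * ·) h1
      simp only [← mul_assoc, ht, one_mul] at h2
      exact Subtype.ext h2
    have := Module.Finite.of_injective f.toIntLinearMap hf
    exact (AddGroup.fg_iff_addSubgroup_fg _).1 (Module.Finite.iff_addGroup_fg.1 this)
  · obtain ⟨m, hm, h⟩ := hΛ.1.2 a
    exact ⟨m, hm, hle h⟩

/-- The right multiplier ring of a left submodule. -/
def rightMultiplier (I : Submodule Λ A) : Subring A where
  carrier := {a | ∀ x ∈ I, x * a ∈ I}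
  zero_mem' := fun x _ => by simp
  one_mem' := fun x hx => by simpa using hx
  add_mem' := fun ha hb x hx => by rw [mul_add]; exact I.add_mem (ha x hx) (hb x hx)
  neg_mem' := fun ha x hx => by rw [mul_neg]; exact I.neg_mem (ha x hx)
  mul_mem' := fun ha hb x hx => by rw [← mul_assoc]; exact hb _ (ha x hx)

/-- The left multiplier ring of a left submodule. -/
def leftMultiplier (I : Submodule Λ A) : Subring A where
  carrier := {a | ∀ x ∈ I, a * x ∈ I}
  zero_mem' := fun x _ => by simp
  one_mem' := fun x hx => by simpa using hx
  add_mem' := fun ha hb x hx => by rw [add_mul]; exact I.add_mem (ha x hx) (hb x hx)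
  neg_mem' := fun ha x hx => by rw [neg_mul]; exact I.neg_mem (ha x hx)
  mul_mem' := fun ha hb x hx => by rw [mul_assoc]; exact ha _ (hb x hx)

variable {I P : Submodule Λ A} {t : K}

/-- For a nonzero central `t ∈ I`, both `I I⁻¹` and `I⁻¹ I` are contained in the maximal order. -/
theorem mul_mem_of_mem_idealInverse (hΛ : IsMaximalZOrder Λ) (hI : IsTwoSidedIdeal Λ I)
    (ht0 : t ≠ 0) (ht : algebraMap K A t ∈ I) {a i : A} (ha : a ∈ idealInverse I) (hi : i ∈ I) :
    i * a ∈ Λ ∧ a * i ∈ Λ := by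
  have hinv : algebraMap K A t⁻¹ * algebraMap K A t = 1 := by
    rw [← map_mul, inv_mul_cancel₀ ht0, map_one]
  constructor
  · have h : leftMultiplier I = Λ := hΛ.eq_of_mul_mem
      (fun r hr x hx => I.smul_mem (⟨r, hr⟩ : Λ) hx) hinv fun r hr => by
        rw [Algebra.commutes]
        exact hI.1 _ (hr _ ht)
    rw [← h]
    exact fun x hx => ha i hi x hx
  · have h : rightMultiplier I = Λ := hΛ.eq_of_mul_mem
      (fun r hr x hx => hI.2 x hx r hr) hinv fun r hr => hI.1 _ (hr _ ht)
    rw [← h]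
    intro x hx
    rw [← mul_assoc]
    exact ha x hx i hi

/-- The form in which coprimality of `t I⁻¹` and `J` is used. If `t = 0` then `J = Λ`, and `a = 0`
does the job. -/
theorem InverseCoprime.exists_add_eq_one (hΛ : IsMaximalZOrder Λ) (hI : IsTwoSidedIdeal Λ I)
    (ht : algebraMap K A t ∈ I) {J : Submodule Λ A} (h : InverseCoprime (algebraMap K A t) I J) :
    ∃ a, ∃ j ∈ J, algebraMap K A t * a + j = 1 ∧ ∀ i ∈ I, i * a ∈ Λ ∧ a * i ∈ Λ := by
  have h1 : (1 : A) ∈ (idealInverse I).map (AddMonoidHom.mulLeft (algebraMap K A t)) ⊔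
      J.toAddSubgroup := by
    rw [h]
    exact Λ.one_mem
  obtain ⟨_, ⟨a, ha, rfl⟩, j, hj, hsum⟩ := AddSubgroup.mem_sup.1 h1
  by_cases ht0 : t = 0
  · refine ⟨0, j, hj, ?_, fun i _ => by simp⟩
    simpa [ht0] using hsum
  · exact ⟨a, j, hj, hsum, fun i hi => mul_mem_of_mem_idealInverse hΛ hI ht0 ht ha hi⟩

theorem IsTwoSidedFractionalIdeal.mul_mem (hP : IsTwoSidedFractionalIdeal K Λ P) {x r : A}
    (hx : x ∈ P) (hr : r ∈ Λ) : x * r ∈ P := by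
  obtain ⟨c, hc, J, hJ, hJP⟩ := hP
  have h1 : c • x ∈ J := by
    rw [← SetLike.mem_coe, hJP]
    exact ⟨x, hx, rfl⟩
  have h2 := hJ.2 _ h1 r hr
  rw [← SetLike.mem_coe, hJP] at h2
  obtain ⟨p, hp, h⟩ := h2
  simp only [smul_mul_assoc] at h
  rwa [← smul_right_injective A hc h]

/-- Multiplying a product of two-sided modules from the right. -/
theorem mul_mem_mul_of_right {Q : Submodule Λ A} (hP : ∀ x ∈ P, ∀ r ∈ Λ, x * r ∈ P) {x r : A}
    (hx : x ∈ Q * P) (hr : r ∈ Λ) : x * r ∈ Q * P := by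
  induction hx using Submodule.mul_induction_on' with
  | mem_mul_mem m hm n hn =>
    rw [mul_assoc]
    exact Submodule.mul_mem_mul hm (hP n hn r hr)
  | add x _ y _ hx hy =>
    rw [add_mul]
    exact add_mem hx hy

theorem chi_mk_eq_mk_iff {J : Submodule Λ A} (ht : algebraMap K A t ∈ I) (x : P)
    (y : (I * P : Submodule Λ A)) :
    chi I J P t ht (Submodule.Quotient.mk x) = Submodule.Quotient.mk y ↔
      algebraMap K A t * (x : A) - y ∈ I * J * P := by
  rw [chi, Submodule.mapQ_apply, Submodule.Quotient.eq]
  rfl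

theorem chi_bijective (hΛ : IsMaximalZOrder Λ) (hI : IsTwoSidedIdeal Λ I)
    (ht : algebraMap K A t ∈ I) {J : Submodule Λ A}
    (h : InverseCoprime (algebraMap K A t) I J) : Function.Bijective (chi I J P t ht) := by
  obtain ⟨a, j, hj, hsum, haI⟩ := h.exists_add_eq_one hΛ hI ht
  constructor
  · rw [injective_iff_map_eq_zero]
    intro x
    induction x using Submodule.Quotient.induction_on with | H x => ?_
    intro hx
    have h1 : algebraMap K A t * (x : A) ∈ I * (J * P) := by
      have := (chi_mk_eq_mk_iff ht x 0).1 (by rw [hx, Submodule.Quotient.mk_zero])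
      simpa [mul_assoc] using this
    have h2 : ∀ z ∈ I * (J * P), a * z ∈ J * P := by
      intro z hz
      induction hz using Submodule.mul_induction_on' with
      | mem_mul_mem m hm n hn =>
        rw [← mul_assoc]
        exact (J * P).smul_mem (⟨a * m, (haI m hm).2⟩ : Λ) hn
      | add x _ y _ hx hy =>
        rw [mul_add]
        exact add_mem hx hy
    rw [Submodule.Quotient.mk_eq_zero]
    change (x : A) ∈ J * P
    have h3 : (x : A) = a * (algebraMap K A t * x) + j * x := by
      rw [← mul_assoc, ← Algebra.commutes, ← add_mul, hsum, one_mul]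
    rw [h3]
    exact add_mem (h2 _ h1) (Submodule.mul_mem_mul hj x.2)
  · intro y
    induction y using Submodule.Quotient.induction_on with | H y => ?_
    have h1 : ∀ z ∈ I * P, ∃ x ∈ P, algebraMap K A t * x - z ∈ I * J * P := by
      intro z hz
      induction hz using Submodule.mul_induction_on' with
      | mem_mul_mem m hm n hn =>
        refine ⟨m * a * n, P.smul_mem (⟨m * a, (haI m hm).1⟩ : Λ) hn, ?_⟩
        have h2 : algebraMap K A t * (m * a * n) - m * n = -(m * j * n) := by
          have h3 : m * n = m * (algebraMap K A t * a + j) * n := by rw [hsum, mul_one]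
          rw [h3, mul_add, add_mul, ← mul_assoc m, ← Algebra.commutes t m]
          simp only [mul_assoc]
          abel
        rw [h2]
        exact neg_mem (Submodule.mul_mem_mul (Submodule.mul_mem_mul hm hj) hn)
      | add z _ z' _ hz hz' =>
        obtain ⟨x, hx, h⟩ := hz
        obtain ⟨x', hx', h'⟩ := hz'
        refine ⟨x + x', add_mem hx hx', ?_⟩
        have := add_mem h h'
        rwa [mul_add, add_sub_add_comm]
    obtain ⟨x, hx, h⟩ := h1 y y.2
    exact ⟨Submodule.Quotient.mk ⟨x, hx⟩, (chi_mk_eq_mk_iff ht _ _).2 h⟩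

/-! ### The ideal generated by a prime number -/

theorem mem_principalIdeal_iff {q : ℕ} {x : A} :
    x ∈ principalIdeal Λ q ↔ ∃ r ∈ Λ, x = q * r := by
  rw [principalIdeal, Submodule.mem_span_singleton]
  constructor
  · rintro ⟨r, rfl⟩
    exact ⟨r, r.2, (Nat.cast_commute q (r : A)).eq.symm⟩
  · rintro ⟨r, hr, rfl⟩
    exact ⟨⟨r, hr⟩, (Nat.cast_commute q r).eq.symm⟩

theorem natCast_mul_mem {q : ℕ} {z : A} (hz : z ∈ I * P) :
    (q : A) * z ∈ I * principalIdeal Λ q * P := by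
  induction hz using Submodule.mul_induction_on' with
  | mem_mul_mem m hm n hn =>
    rw [← mul_assoc, (Nat.cast_commute q m).eq]
    exact Submodule.mul_mem_mul (Submodule.mul_mem_mul hm
      (mem_principalIdeal_iff.2 ⟨1, Λ.one_mem, (mul_one _).symm⟩)) hn
  | add x _ y _ hx hy =>
    rw [mul_add]
    exact add_mem hx hy

/-- Iterating `I ⊆ t Λ + q I`. -/
theorem InverseCoprime.exists_eq_mul_add (hΛ : IsMaximalZOrder Λ) (hI : IsTwoSidedIdeal Λ I)
    (ht : algebraMap K A t ∈ I) {q : ℕ}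
    (h : InverseCoprime (algebraMap K A t) I (principalIdeal Λ q)) (e : ℕ) :
    ∀ i ∈ I, ∃ r ∈ Λ, ∃ i' ∈ I, i = algebraMap K A t * r + (q : A) ^ e * i' := by
  obtain ⟨a, j, hj, hsum, haI⟩ := h.exists_add_eq_one hΛ hI ht
  obtain ⟨l, hl, rfl⟩ := mem_principalIdeal_iff.1 hj
  induction e with
  | zero => exact fun i hi => ⟨0, Λ.zero_mem, i, hi, by simp⟩
  | succ e ih =>
    intro i hi
    obtain ⟨r, hr, i', hi', h1⟩ := ih i hi
    refine ⟨r + q ^ e * (i' * a), add_mem hr (mul_mem (pow_mem (natCast_mem Λ q) e)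
      (haI i' hi').1), i' * l, hI.2 _ hi' l hl, ?_⟩
    have h2 : i' = algebraMap K A t * (i' * a) + q * (i' * l) := by
      calc i' = i' * (algebraMap K A t * a + q * l) := by rw [hsum, mul_one]
        _ = _ := by
          rw [mul_add, ← mul_assoc, ← Algebra.commutes t i', mul_assoc, ← mul_assoc i',
            ← (Nat.cast_commute q i').eq, mul_assoc]
    calc i = algebraMap K A t * r + (q : A) ^ e * i' := h1
      _ = algebraMap K A t * r + (q : A) ^ e * (algebraMap K A t * (i' * a) + q * (i' * l)) := by
        rw [← h2]
      _ = _ := by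
        rw [mul_add, mul_add, ← mul_assoc ((q : A) ^ e), ← Algebra.commutes t ((q : A) ^ e),
          pow_succ]
        simp only [mul_assoc, add_assoc]

/-- If `q ^ e * d` is a multiple of `t`, then `d I P` is divisible by `t`: the index of `t P` in
`I P` is prime to `q`. -/
theorem InverseCoprime.exists_intCast_mul_eq (hΛ : IsMaximalZOrder Λ) (hI : IsTwoSidedIdeal Λ I)
    (ht : algebraMap K A t ∈ I) {q : ℕ}
    (h : InverseCoprime (algebraMap K A t) I (principalIdeal Λ q)) {e : ℕ} {d : ℤ} {c : A}
    (hc : c ∈ Λ) (hd : algebraMap K A t * c = (q : A) ^ e * d) {y : A} (hy : y ∈ I * P) :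
    ∃ p ∈ P, (d : A) * y = algebraMap K A t * p := by
  induction hy using Submodule.mul_induction_on' with
  | mem_mul_mem i hi p hp =>
    obtain ⟨r, hr, i', hi', h1⟩ := h.exists_eq_mul_add hΛ hI ht e i hi
    refine ⟨(d * r + c * i') * p, P.smul_mem (⟨d * r + c * i', add_mem
      (mul_mem (intCast_mem Λ d) hr) (mul_mem hc (hI.1 _ hi'))⟩ : Λ) hp, ?_⟩
    rw [← mul_assoc, ← mul_assoc]
    congr 1
    rw [mul_add, ← mul_assoc _ c, hd, h1, mul_add, ← mul_assoc _ _ r, ← mul_assoc _ _ i',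
      ← Algebra.commutes t (d : A), mul_assoc (algebraMap K A t), (Int.cast_commute d r).eq,
      (Int.cast_commute d ((q : A) ^ e)).eq]
  | add x _ y _ hx hy =>
    obtain ⟨p, hp, h1⟩ := hx
    obtain ⟨p', hp', h2⟩ := hy
    exact ⟨p + p', add_mem hp hp', by rw [mul_add, mul_add, h1, h2]⟩

/-- `t` cannot vanish, because a prime number is not a unit in a nonzero order. -/
theorem InverseCoprime.ne_zero [Nontrivial A] {N : ℕ} (b : Module.Basis (Fin N) ℤ Λ) {q : ℕ}
    (hq : q.Prime) (h : InverseCoprime (algebraMap K A t) I (principalIdeal Λ q)) : t ≠ 0 := by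
  rintro rfl
  have h1 : (1 : A) ∈ (idealInverse I).map (AddMonoidHom.mulLeft (algebraMap K A 0)) ⊔
      (principalIdeal Λ q).toAddSubgroup := by
    rw [h]
    exact Λ.one_mem
  obtain ⟨_, ⟨a, ha, rfl⟩, j, hj, hsum⟩ := AddSubgroup.mem_sup.1 h1
  obtain ⟨l, hl, rfl⟩ := mem_principalIdeal_iff.1 hj
  have hsum' : (q : A) * l = 1 := by simpa using hsum
  have h2 : (q : ℤ) • (⟨l, hl⟩ : Λ) = 1 := by
    ext
    simpa using hsum'
  obtain ⟨i⟩ : Nonempty (Fin N) := b.index_nonempty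
  have h3 : (q : ℤ) • ((⟨l, hl⟩ : Λ) * b i) = b i := by
    rw [← smul_mul_assoc, h2, one_mul]
  have h4 := congrArg (fun x => b.repr x i) h3
  simp only [map_smul, Finsupp.smul_apply, Module.Basis.repr_self, Finsupp.single_eq_same,
    smul_eq_mul] at h4
  have h5 := Int.isUnit_iff_natAbs_eq.1 (IsUnit.of_mul_eq_one _ h4)
  exact hq.one_lt.ne' (by simpa using h5)

end MaximalOrder

/-! ### Reading the input -/

namespace BitCost

theorem le_inputSize {inp : List (List ℤ)} {l : List ℤ} (hl : l ∈ inp) :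
    (l.map fun z => bitLength z + 1).sum ≤ inputSize inp :=
  (Nat.le_succ _).trans (List.single_le_sum (fun _ _ => Nat.zero_le _) _
    (List.mem_map_of_mem (f := fun l : List ℤ => (l.map fun z => bitLength z + 1).sum + 1) hl))

theorem length_le_inputSize {inp : List (List ℤ)} {l : List ℤ} (hl : l ∈ inp) :
    l.length ≤ inputSize inp := by
  refine le_trans ?_ (le_inputSize hl)
  refine le_trans ?_ (List.length_le_sum_of_one_le (l.map fun z => bitLength z + 1) ?_)
  · simp
  · simp

theorem bitLength_load_le (inp : List (List ℤ)) : Bounded (inputSize inp) (load inp) := by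
  intro a i
  rw [load]
  split_ifs
  · rcases lt_or_ge a inp.length with ha | ha
    · rw [List.getD_eq_getElem _ _ ha]
      rcases lt_or_ge i.toNat inp[a].length with hi | hi
      · rw [List.getD_eq_getElem _ _ hi]
        refine le_trans ?_ (le_inputSize (List.getElem_mem ha))
        exact (Nat.le_succ _).trans (List.single_le_sum (fun _ _ => Nat.zero_le _) _
          (List.mem_map_of_mem (f := fun z => bitLength z + 1) (List.getElem_mem hi)))
      · rw [List.getD_eq_default _ _ hi]
        simp [bitLength]
    · rw [List.getD_eq_default _ _ ha]
      simp [bitLength]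
  · simp [bitLength]

theorem getD_ofFn {n : ℕ} (f : Fin n → ℤ) (i : ℕ) :
    (List.ofFn f).getD i 0 = if h : i < n then f ⟨i, h⟩ else 0 := by
  split_ifs with h
  · rw [List.getD_eq_getElem _ _ (by simpa using h), List.getElem_ofFn]
  · exact List.getD_eq_default _ _ (by simpa using h)

end BitCost

section Encoding

open BitCost

variable {N : ℕ} (w : InversionInput N)

theorem load_encode_table (i j k : Fin N) :
    load w.encode 1 (((i * N + j) * N + k : ℕ) : ℤ) = w.table i j k := by
  have hN : 0 < N := i.pos
  have hlt : ((i : ℕ) * N + j) * N + k < N * N * N := by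
    calc ((i : ℕ) * N + j) * N + k < ((i : ℕ) * N + j) * N + N := by gcongr; exact k.2
      _ = ((i : ℕ) * N + j + 1) * N := by ring
      _ ≤ (i * N + N) * N := Nat.mul_le_mul_right _ (Nat.add_le_add_left j.2 _)
      _ = (i + 1) * N * N := by ring
      _ ≤ N * N * N := by gcongr; exact i.2
  have h1 : load w.encode 1 (((i * N + j) * N + k : ℕ) : ℤ) = (List.ofFn fun k : Fin (N * N * N) =>
      w.table k.divNat.divNat k.divNat.modNat k.modNat).getD ((i * N + j) * N + k) 0 := by
    rw [load, if_pos (Int.natCast_nonneg _)]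
    rfl
  have h2 : (((i : ℕ) * N + j) * N + k) / N = i * N + j := by
    rw [mul_comm, Nat.mul_add_div hN, Nat.div_eq_of_lt k.2, add_zero]
  have h3 : ((i : ℕ) * N + j) / N = i := by
    rw [mul_comm, Nat.mul_add_div hN, Nat.div_eq_of_lt j.2, add_zero]
  rw [h1, getD_ofFn, dif_pos hlt]
  congr 1 <;> ext
  · simp [Fin.divNat, h2, h3]
  · simp [Fin.divNat, Fin.modNat, h2, Nat.mod_eq_of_lt j.2]
  · simp [Fin.modNat, Nat.mod_eq_of_lt k.2]

theorem sum_range_sq {N : ℕ} (f : ℕ → ℕ → ℤ) :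
    ∑ r ∈ Finset.range (N * N), f (r / N) (r % N) = ∑ i : Fin N, ∑ j : Fin N, f i j := by
  rw [Finset.sum_range, ← Fintype.sum_prod_type']
  exact Fintype.sum_equiv finProdFinEquiv.symm _ _ fun r => rfl

theorem sum_range_cube {N : ℕ} (f : ℕ → ℕ → ℕ → ℤ) :
    ∑ r ∈ Finset.range (N * N * N), f (r / N / N) (r / N % N) (r % N) =
      ∑ i : Fin N, ∑ j : Fin N, ∑ k : Fin N, f i j k := by
  have h1 : ∑ r ∈ Finset.range (N * N * N), f (r / N / N) (r / N % N) (r % N) =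
      ∑ r : Fin (N * N), ∑ k : Fin N, f (r / N) (r % N) k := by
    rw [Finset.sum_range, ← Fintype.sum_prod_type']
    exact Fintype.sum_equiv finProdFinEquiv.symm _ _ fun r => rfl
  rw [h1, ← Finset.sum_range fun r => ∑ k : Fin N, f (r / N) (r % N) k,
    sum_range_sq fun i j => ∑ k : Fin N, f i j k]

variable {K A : Type*} [Field K] [Ring A] [Algebra K A] {Λ : Subring A}

/-- The coordinates of an element of the order, continued by zero. -/
noncomputable def coordinates (b : Module.Basis (Fin N) ℤ Λ) (x : Λ) (i : ℕ) : ℤ :=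
  if h : i < N then b.repr x ⟨i, h⟩ else 0

@[simp]
theorem coordinates_fin (b : Module.Basis (Fin N) ℤ Λ) (x : Λ) (i : Fin N) :
    coordinates b x i = b.repr x i := by
  simp [coordinates]

theorem coordinates_add (b : Module.Basis (Fin N) ℤ Λ) (x y : Λ) (i : ℕ) :
    coordinates b (x + y) i = coordinates b x i + coordinates b y i := by
  simp only [coordinates]
  split_ifs <;> simp

theorem coordinates_smul (b : Module.Basis (Fin N) ℤ Λ) (c : ℤ) (x : Λ) (i : ℕ) :
    coordinates b (c • x) i = c * coordinates b x i := by
  simp only [coordinates, map_smul]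
  split_ifs <;> simp

variable {w} {b : Module.Basis (Fin N) ℤ Λ}

theorem repr_mul (htab : ∀ i j, b i * b j = ∑ k, w.table i j k • b k) (x y : Λ) (k : Fin N) :
    b.repr (x * y) k = ∑ i, ∑ j, b.repr x i * b.repr y j * w.table i j k := by
  conv_lhs => rw [← b.sum_repr x, ← b.sum_repr y, Finset.sum_mul_sum]
  simp only [smul_mul_smul_comm, htab, map_sum, map_smul, Finsupp.coe_finsetSum,
    Finset.sum_apply, Finsupp.smul_apply, Module.Basis.repr_self, smul_eq_mul]
  refine Finset.sum_congr rfl fun i _ => Finset.sum_congr rfl fun j _ => ?_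
  simp [Finsupp.single_apply]

theorem partialMul_coordinates (htab : ∀ i j, b i * b j = ∑ k, w.table i j k • b k) (x y : Λ)
    {k : ℕ} (hk : k < N) :
    partialMul N (coordinates b x) (coordinates b y) (fun i => load w.encode 1 i) (N * N * N) k =
      coordinates b (x * y) k := by
  have h1 := sum_range_cube (N := N) fun i j l => if l = k then
    coordinates b x i * coordinates b y j * load w.encode 1 (((i * N + j) * N + l : ℕ) : ℤ) else 0
  have h2 : ∀ r, (r / N / N * N + r / N % N) * N + r % N = r := fun r => by
    rw [Nat.div_add_mod', Nat.div_add_mod']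
  simp only [h2] at h1
  rw [partialMul, h1, show k = ((⟨k, hk⟩ : Fin N) : ℕ) from rfl, coordinates_fin, repr_mul htab]
  refine Finset.sum_congr rfl fun i _ => Finset.sum_congr rfl fun j _ => ?_
  rw [Finset.sum_eq_single ⟨k, hk⟩]
  · rw [if_pos rfl, load_encode_table, coordinates_fin, coordinates_fin]
  · intro l _ hl
    rw [if_neg fun h => hl (Fin.ext h)]
  · simp

theorem partialTrace_coordinates (htab : ∀ i j, b i * b j = ∑ k, w.table i j k • b k) (x : Λ) :
    partialTrace N (coordinates b x) (fun i => load w.encode 1 i) (N * N) =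
      (Algebra.leftMulMatrix b x).trace := by
  have h1 := sum_range_sq (N := N) fun i j =>
    coordinates b x i * load w.encode 1 (((i * N + j) * N + j : ℕ) : ℤ)
  simp only [Nat.div_add_mod'] at h1
  rw [partialTrace, h1, Matrix.trace, Finset.sum_comm]
  refine Finset.sum_congr rfl fun j _ => ?_
  rw [Matrix.diag_apply, Algebra.leftMulMatrix_eq_repr_mul, repr_mul htab]
  refine Finset.sum_congr rfl fun i _ => ?_
  rw [load_encode_table, coordinates_fin]
  simp [Finsupp.single_apply]

theorem isFaddeevLeVerrier_coordinates
    (htab : ∀ i j, b i * b j = ∑ k, w.table i j k • b k) (τ η : Λ) :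
    IsFaddeevLeVerrier N (fun i => load w.encode 1 i) (coordinates b τ) (coordinates b η)
      (fun k => (Algebra.leftMulMatrix b τ).charpoly.coeff (N - 1 - k))
      (fun k => coordinates b (τ * hornerSeq b τ k))
      (fun k => coordinates b (hornerSeq b τ k * η)) where
  left_zero i _ := by simp [hornerSeq]
  right_zero i _ := by simp [hornerSeq]
  coeff k hk := by
    rw [partialTrace_coordinates htab, trace_leftMulMatrix_mul_hornerSeq b τ (by omega),
      zero_sub, neg_neg, Int.mul_ediv_cancel_left _ (by omega)]
  left_succ k _ i hi := by
    rw [partialMul_coordinates htab _ _ hi, ← coordinates_smul, ← coordinates_add, hornerSeq,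
      mul_add, mul_smul_comm, mul_one]
  right_succ k _ i hi := by
    rw [partialMul_coordinates htab _ _ hi, ← coordinates_smul, ← coordinates_add, hornerSeq,
      add_mul, smul_mul_assoc, one_mul, mul_assoc]

/-! ### Correctness and cost of the inversion program -/

/-- The number of binary digits that suffices for all integers occurring in the computation, in
terms of the input size. -/
def wordSize {R : Type*} [CommSemiring R] (n : R) : R := n * (4 * n + 2) + 1

/-- The polynomial that bounds the cost of `inversionProg`. -/
noncomputable def inversionBound : Polynomial ℕ :=
  inversionProg.costBound (wordSize Polynomial.X) (wordSize Polynomial.X)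

theorem eval_inversionBound (n : ℕ) :
    inversionBound.eval n = inversionProg.costBound (wordSize n) (wordSize n) := by
  rw [inversionBound, ← Polynomial.coe_evalRingHom, Prog.map_costBound]
  simp [wordSize]

theorem resources_encode (hN : 0 < N) :
    Resources (wordSize (inputSize w.encode)) (wordSize (inputSize w.encode)) N
      (2 ^ inputSize w.encode) (fun i => load w.encode 1 i) (fun i => load w.encode 4 i)
      (fun i => load w.encode 5 i) := by
  have hcell : ∀ a i, |load w.encode a i| ≤ 2 ^ inputSize w.encode := fun a i =>
    (bitLength_le_iff.1 (bitLength_load_le w.encode a i)).le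
  have hcube : N * N * N ≤ inputSize w.encode := by
    have := length_le_inputSize (inp := w.encode) (l := List.ofFn fun k : Fin (N * N * N) =>
      w.table k.divNat.divNat k.divNat.modNat k.modNat) (by simp [InversionInput.encode])
    rwa [List.length_ofFn] at this
  set n := inputSize w.encode
  have hNn : N ≤ n := le_trans (Nat.le_mul_of_pos_left N (by positivity)) hcube
  refine ⟨hN, ?_, ?_, ?_, ?_, fun _ _ => hcell _ _, fun _ _ => hcell _ _, fun _ _ => hcell _ _⟩
  · exact le_self_pow₀ (by norm_num) (by omega)
  · exact_mod_cast hcube.trans Nat.lt_two_pow_self.le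
  · refine hcube.trans ?_
    rw [wordSize]
    nlinarith
  · rw [← pow_mul]
    refine pow_lt_pow_right₀ (by norm_num) ?_
    rw [wordSize, Nat.lt_add_one_iff]
    gcongr

theorem smul_eq_coe_sum_of_describes {v : Fin N → ℤ} {den : ℤ} {a : A} (h : Describes b den v a) :
    den • a = ((∑ i, v i • b i : Λ) : A) := by
  rw [h.2]
  simp

theorem coordinates_sum (v : Fin N → ℤ) :
    coordinates b (∑ i, v i • b i) = fun i => (List.ofFn v).getD i 0 := by
  funext i
  rw [getD_ofFn, coordinates]
  split_ifs
  · rw [b.repr_sum_self]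
  · rfl

/-- On every valid input `inversionProg` halts within the cost bound and inverts `χ_t`. The
correctness argument multiplies the output by `t` and uses `t c = q ^ e d` and `d y = t p`. -/
theorem inversionProg_spec [Nontrivial A] {I P : Submodule Λ A} (hΛ : IsMaximalZOrder Λ)
    (hI : IsTwoSidedIdeal Λ I) {t : K} (ht : algebraMap K A t ∈ I) {q : ℕ} (hq : q.Prime)
    (hcop : InverseCoprime (algebraMap K A t) I (principalIdeal Λ q))
    (y : (I * P : Submodule Λ A)) (hw : w.IsFor b I P q (algebraMap K A t) y) :
    ∃ (s : Store) (cost : ℕ) (x : P), Run inversionProg (load w.encode) s cost ∧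
      cost ≤ inversionBound.eval (inputSize w.encode) ∧ OutputDescribes b s (x : A) ∧
      chi I (principalIdeal Λ q) P t ht (Submodule.Quotient.mk x) = Submodule.Quotient.mk y := by
  have hN : 0 < N := by
    obtain ⟨i⟩ := b.index_nonempty
    exact i.pos
  have ht0 : t ≠ 0 := hcop.ne_zero b hq
  -- `t` is a nonzero element of the field `K`, hence invertible in `A`
  have hcancel : ∀ {u v : A}, algebraMap K A t * u = algebraMap K A t * v → u = v := by
    intro u v huv
    have := congrArg (algebraMap K A t⁻¹ * ·) huv
    simpa [← mul_assoc, ← map_mul, inv_mul_cancel₀ ht0] using this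
  set τ : Λ := ∑ i, w.t i • b i with hτ
  set η : Λ := ∑ i, w.y i • b i with hη
  have hτA : (τ : A) = algebraMap K A t := by
    rw [← smul_eq_coe_sum_of_describes hw.elt, one_smul]
  have hηA : (η : A) = w.denY • (y : A) := (smul_eq_coe_sum_of_describes hw.target).symm
  have h4 : (fun i : ℕ => load w.encode 4 i) = coordinates b τ := by
    rw [hτ, coordinates_sum]
    funext i
    rw [load, if_pos (Int.natCast_nonneg i)]
    rfl
  have h5 : (fun i : ℕ => load w.encode 5 i) = coordinates b η := by
    rw [hη, coordinates_sum]
    funext i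
    rw [load, if_pos (Int.natCast_nonneg i)]
    rfl
  have hF := isFaddeevLeVerrier_coordinates hw.table τ η
  have hR := resources_encode (w := w) hN
  rw [h4, h5] at hR
  set f := (Algebra.leftMulMatrix b τ).charpoly
  have hf0 : f.coeff 0 ≠ 0 := charpoly_leftMulMatrix_coeff_zero_ne_zero b τ fun x hx => by
    ext
    refine hcancel ?_
    rw [← hτA]
    simpa using congrArg Subtype.val hx
  have hD : partialTrace N (coordinates b (τ * hornerSeq b τ (N - 1)))
      (fun i => load w.encode 1 i) (N * N) / N = -f.coeff 0 := by
    rw [partialTrace_coordinates hw.table, trace_leftMulMatrix_mul_hornerSeq b τ (by omega),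
      Nat.sub_self, ← mul_neg, ← Nat.cast_succ, Nat.succ_eq_add_one, Nat.sub_add_cancel hN,
      Int.mul_ediv_cancel_left _ (by omega)]
  have hcell := bitLength_load_le w.encode
  have hword : inputSize w.encode ≤ wordSize (inputSize w.encode) := by
    rw [wordSize]
    nlinarith
  have h01 : load w.encode 0 1 = q := by
    rw [← hw.prime]
    rfl
  obtain ⟨s, cost, hrun, hcost, -, e, d, g, hed, -, hgd, hs0, hs1⟩ :=
    hR.achieves_inversionProg (q := q) hF (fun a i => (hcell a i).trans hword) le_rfl rfl rfl h4 h5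
      hq h01 (h01 ▸ (le_abs_self _).trans (bitLength_le_iff.1 (hcell 0 1)).le)
      (bitLength_le_iff.1 (hcell 0 4)).le (by rw [hD]; exact neg_ne_zero.2 hf0)
  have h04 : load w.encode 0 4 = w.denY := rfl
  rw [hD] at hed
  set c := hornerSeq b τ (N - 1)
  have hcA : algebraMap K A t * (c : A) = (q : A) ^ e * (d : A) := by
    have h1 := congrArg (Subtype.val : Λ → A) (mul_hornerSeq_last b τ hN)
    rw [← hτA]
    refine h1.trans ?_
    change ((-f.coeff 0 • (1 : Λ) : Λ) : A) = _
    rw [hed]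
    simp
  obtain ⟨p, hp, hdp⟩ := hcop.exists_intCast_mul_eq hΛ hI ht c.2 hcA y.2
  -- `d y = t p`, so `g p = g d t⁻¹ y` is the required element
  have hgp : (g : A) * p ∈ P := P.smul_mem (⟨g, intCast_mem Λ g⟩ : Λ) hp
  refine ⟨s, cost, ⟨(g : A) * p, hgp⟩, hrun, ?_, ⟨?_, ?_⟩, ?_⟩
  · rwa [eval_inversionBound]
  · rw [hs0, h04]
    exact mul_ne_zero (pow_ne_zero _ (by exact_mod_cast hq.ne_zero)) hw.target.1
  · have h1 : ∑ i : Fin N, s 0 ((i : ℕ) + 1) • (b i : A) = (g : A) * (c * η) := by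
      have h2 : ∀ i : Fin N, s 0 ((i : ℕ) + 1) • (b i : A) =
          (g : A) * ((b.repr (c * η) i • b i : Λ) : A) := fun i => by
        rw [hs1 i i.2, coordinates_fin]
        simp [mul_assoc]
      rw [Finset.sum_congr rfl fun i _ => h2 i, ← Finset.mul_sum,
        ← AddSubmonoidClass.coe_finsetSum, b.sum_repr]
      rfl
    rw [h1, hs0, h04]
    refine hcancel ?_
    have e1 : algebraMap K A t * ((g : A) * (c * η)) =
        (g : A) * ((q : A) ^ e * d * (w.denY • (y : A))) := by
      rw [← hηA, ← hcA, ← mul_assoc, Algebra.commutes, mul_assoc, mul_assoc]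
    have e2 : algebraMap K A t * ((q ^ e * w.denY : ℤ) • ((g : A) * p)) =
        (q ^ e * w.denY : ℤ) • ((g : A) * (d * y)) := by
      rw [mul_smul_comm, hdp, ← mul_assoc, Algebra.commutes, mul_assoc]
    rw [e1, e2]
    have e3 : (q : A) ^ e = ((q ^ e : ℤ) : A) := by push_cast; rfl
    rw [e3, mul_assoc]
    simp only [← zsmul_eq_mul, smul_smul]
    congr 1
    ring
  · rw [chi_mk_eq_mk_iff]
    obtain ⟨k, hk⟩ := hgd
    have h1 : algebraMap K A t * ((g : A) * p) - y = (q : A) * ((k : A) * y) := by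
      rw [← mul_assoc, Algebra.commutes, mul_assoc, ← hdp, ← mul_assoc, ← mul_assoc,
        ← Int.cast_natCast (R := A) q, ← Int.cast_mul, ← Int.cast_mul, ← hk]
      push_cast
      rw [sub_mul, one_mul]
    rw [h1]
    exact natCast_mul_mem ((I * P).smul_mem (⟨k, intCast_mem Λ k⟩ : Λ) y.2)

end Encoding

instance {K L : Type*} [Field K] [Field L] [Algebra K L] [FiniteDimensional K L]
    (θ : L ≃ₐ[K] L) (γ : K) : Nontrivial (CyclicAlgebra θ γ) :=
  ⟨⟨1, 0, fun h => by
    have h0 := congrFun h ⟨0, orderOf_pos θ⟩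
    rw [CyclicAlgebra.one_apply, CyclicAlgebra.zero_apply, if_pos rfl] at h0
    exact one_ne_zero h0⟩⟩

universe u v

theorem mainTheorem8 :
    ∃ (prog : BitCost.Prog) (bound : Polynomial ℕ),
      ∀ (K : Type u) (L : Type v) [Field K] [Field L] [NumberField K] [NumberField L]
        [Algebra K L] [IsGalois K L]
        (θ : L ≃ₐ[K] L) (_hθ : ∀ σ : L ≃ₐ[K] L, σ ∈ Subgroup.zpowers θ)
        (γ : 𝓞 K) (_hγ : γ ≠ 0)
        (_hdiv : ∀ a : CyclicAlgebra θ (γ : K), a ≠ 0 → ∃ a' : CyclicAlgebra θ (γ : K), a * a' = 1)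
        (_hmax : IsMaximalZOrder (naturalOrder θ γ))
        (I P : Submodule (naturalOrder θ γ) (CyclicAlgebra θ (γ : K)))
        (_hI : IsTwoSidedIdeal (naturalOrder θ γ) I)
        (_hP : IsTwoSidedFractionalIdeal K (naturalOrder θ γ) P)
        (t : 𝓞 K) (ht : algebraMap K (CyclicAlgebra θ (γ : K)) (t : K) ∈ I),
        -- multiplication by `t` induces an isomorphism of left and right modules
        (∀ J : Submodule (naturalOrder θ γ) (CyclicAlgebra θ (γ : K)),
          IsTwoSidedIdeal (naturalOrder θ γ) J →
          InverseCoprime (algebraMap K (CyclicAlgebra θ (γ : K)) (t : K)) I J →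
          Function.Bijective (chi I J P (t : K) ht) ∧
          ∀ (x x' : P) (y y' : (I * P : Submodule _ _)) (r : naturalOrder θ γ),
            (x' : CyclicAlgebra θ (γ : K)) = x * r → (y' : CyclicAlgebra θ (γ : K)) = y * r →
            chi I J P (t : K) ht (Submodule.Quotient.mk x) = Submodule.Quotient.mk y →
            chi I J P (t : K) ht (Submodule.Quotient.mk x') = Submodule.Quotient.mk y') ∧
        -- for `J = ⟨q⟩` the inverse is computed in polynomial time
        (∀ q : ℕ, q.Prime →
          InverseCoprime (algebraMap K (CyclicAlgebra θ (γ : K)) (t : K)) I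
            (principalIdeal (naturalOrder θ γ) q) →
          ∀ (N : ℕ) (b : Module.Basis (Fin N) ℤ (naturalOrder θ γ))
            (y : (I * P : Submodule _ _)) (w : InversionInput N),
            w.IsFor b I P q (algebraMap K (CyclicAlgebra θ (γ : K)) (t : K)) y →
            ∃ (s : BitCost.Store) (cost : ℕ) (x : P),
              BitCost.Run prog (BitCost.load w.encode) s cost ∧
              cost ≤ bound.eval (BitCost.inputSize w.encode) ∧
              OutputDescribes b s (x : CyclicAlgebra θ (γ : K)) ∧
              chi I (principalIdeal (naturalOrder θ γ) q) P (t : K) ht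
                (Submodule.Quotient.mk x) = Submodule.Quotient.mk y) := by
  refine ⟨BitCost.inversionProg, inversionBound, ?_⟩
  intro K L _ _ _ _ _ _ θ _ γ _ _ hmax I P hI hP t ht
  have : FiniteDimensional K L := Module.Finite.of_restrictScalars_finite ℚ K L
  refine ⟨fun J hJ hcop => ⟨chi_bijective hmax hI ht hcop, ?_⟩, ?_⟩
  · intro x x' y y' r hx hy h
    rw [chi_mk_eq_mk_iff] at h ⊢
    rw [hx, hy, ← mul_assoc, ← sub_mul]
    exact mul_mem_mul_of_right (fun z hz r hr => hP.mul_mem hz hr) h r.2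
  · intro q hq hcop N b y w hw
    exact inversionProg_spec hmax hI ht hq hcop y hw
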